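/- Let $N\ge 2$ and $n\ge 2$, and let $\Omega\subset\mathbb R^N$ be an open ball $\{|x-x_0|<r\}$, the exterior of a ball $\{|x-x_0|>r\}$ (with $r>0$), or an open half-space $\{\alpha\cdot x>b\}$ (with $\alpha\in\mathbb R^N\setminus\{0\}$, $b\in\mathbb R$). Let $a_1,\dots,a_n$ be pairwise distinct points of the boundary $\partial\Omega$, and put $$V(x)=\sum_{1\le i<j\le n}\frac{|a_i-a_j|^2}{|x-a_i|^2|x-a_j|^2}.$$ Let $D^{1,2}(\Omega)$ be the completion of $C_c^\infty(\Omega)$ with respect to the norm $\big(\int_\Omega|\nabla u|^2\,dx\big)^{1/2}$ (for these domains it is a space of functions in $L^2_{loc}(\Omega)$ with weak gradient in $L^2(\Omega)$), let $H^1_0(\Omega)$ be the closure of $C_c^\infty(\Omega)$ in $H^1(\Omega)$, and define $$\mu^\star(\Omega)=\inf_{u\in D^{1,2}(\Omega)\setminus\{0\}}\frac{\int_\Omega|\nabla u|^2\,dx}{\int_\Omega V u^2\,dx}.$$ Then $$\mu^\star(\Omega)=\frac{N^2}{n^2}.$$ If $\Omega$ is a ball, then $\mu^\star(\Omega)$ is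 attained by some nonzero $u\in H^1_0(\Omega)$ if and only if $n\ge 3$. If $\Omega$ is the exterior of a ball, then $\mu^\star(\Omega)$ is attained by some nonzero $u\in D^{1,2}(\Omega)$ when $N\ge 3$ and $n\ge 3$. If $\Omega$ is a half-space, then $\mu^\star(\Omega)$ is attained by some nonzero $u\in D^{1,2}(\Omega)$ when $n\ge 3$. -/

import Mathlib

open MeasureTheory Filter Topology TopologicalSpace
open scoped ENNReal ContDiff

noncomputable section

namespace MultipolarHardy

/-- The Euclidean space of dimension `N`. -/
abbrev E (N : ℕ) : Type := EuclideanSpace ℝ (Fin N)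

/-- The multi-singular potential
`V(x) = ∑_{i < j} |a i - a j|² / (|x - a i|² |x - a j|²)`. -/
def potential {N n : ℕ} (a : Fin n → E N) (x : E N) : ℝ :=
  ∑ i : Fin n, ∑ j ∈ Finset.Ioi i,
    ‖a i - a j‖ ^ 2 / (‖x - a i‖ ^ 2 * ‖x - a j‖ ^ 2)

/-- `G` is the weak gradient of `u` in the open set `Ω`: for every smooth test function `ψ`
with compact support in `Ω`, `∫_Ω u ∇ψ = - ∫_Ω ψ G`.  (Used only for `u` and `G` that are square
integrable on the compact subsets of `Ω`, so that both integrals converge.) -/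
def IsWeakGradient {N : ℕ} (Ω : Opens (E N)) (u : E N → ℝ) (G : E N → E N) : Prop :=
  ∀ ψ : TestFunction Ω ℝ ⊤,
    ∫ x in (Ω : Set (E N)), u x • gradient ψ x = - ∫ x in (Ω : Set (E N)), ψ x • G x

/-- `u` belongs to `D^{1,2}(Ω)`, with weak gradient `G`.

The space `D^{1,2}(Ω)` is the completion of `C_c^∞(Ω)` for the norm `(∫_Ω |∇φ|²)^{1/2}`; that is,
`∇u = G` runs through the `L²(Ω)`-closure of the gradients of the test functions.
The elements are realized as functions: `u` is the limit in `L²_loc(Ω)` of test functions `φ k`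
whose gradients converge to `G` in `L²(Ω)`.  (On a ball, the exterior of a ball and a half-space
the `L²`-norm on a compact subset of `Ω` is controlled by the gradient norm, so that each element
of the completion is represented by exactly one such function, up to null sets.) -/
structure MemD12 {N : ℕ} (Ω : Opens (E N)) (u : E N → ℝ) (G : E N → E N) : Prop where
  aestronglyMeasurable : AEStronglyMeasurable u (volume.restrict Ω)
  memLp_loc : ∀ K : Set (E N), IsCompact K → K ⊆ Ω → MemLp u 2 (volume.restrict K)
  memLp_grad : MemLp G 2 (volume.restrict Ω)
  weakGradient : IsWeakGradient Ω u G
  approx : ∃ φ : ℕ → TestFunction Ω ℝ ⊤,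
    (∀ K : Set (E N), IsCompact K → K ⊆ Ω →
      Tendsto (fun k => eLpNorm (fun x => φ k x - u x) 2 (volume.restrict K)) atTop (𝓝 0)) ∧
    Tendsto (fun k => eLpNorm (fun x => gradient (φ k) x - G x) 2 (volume.restrict Ω))
      atTop (𝓝 0)

/-- `u` belongs to `H¹₀(Ω)`, the closure of `C_c^∞(Ω)` in `H¹(Ω)`, with weak gradient `G`. -/
structure MemH10 {N : ℕ} (Ω : Opens (E N)) (u : E N → ℝ) (G : E N → E N) : Prop where
  memLp : MemLp u 2 (volume.restrict Ω)
  memLp_grad : MemLp G 2 (volume.restrict Ω)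
  weakGradient : IsWeakGradient Ω u G
  approx : ∃ φ : ℕ → TestFunction Ω ℝ ⊤,
    Tendsto (fun k => eLpNorm (fun x => φ k x - u x) 2 (volume.restrict Ω)) atTop (𝓝 0) ∧
    Tendsto (fun k => eLpNorm (fun x => gradient (φ k) x - G x) 2 (volume.restrict Ω))
      atTop (𝓝 0)

/-- `u` is not the zero element: it does not vanish almost everywhere in `Ω`. -/
def Nontrivial {N : ℕ} (Ω : Opens (E N)) (u : E N → ℝ) : Prop :=
  ¬ u =ᵐ[volume.restrict Ω] 0

/-- The quotient `∫_Ω |G|² / ∫_Ω V u²` in `[0, ∞]`, where `G` stands for `∇u`. -/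
def quotient {N n : ℕ} (Ω : Opens (E N)) (a : Fin n → E N) (u : E N → ℝ) (G : E N → E N) :
    ℝ≥0∞ :=
  (∫⁻ x in (Ω : Set (E N)), ENNReal.ofReal (‖G x‖ ^ 2)) /
    ∫⁻ x in (Ω : Set (E N)), ENNReal.ofReal (potential a x * u x ^ 2)

/-- The optimal Hardy constant `μ*(Ω; a₁, …, aₙ)`: the infimum of the quotient over the nonzero
elements of `D^{1,2}(Ω)`. -/
def hardyConstant {N n : ℕ} (Ω : Opens (E N)) (a : Fin n → E N) : ℝ≥0∞ :=
  sInf {q | ∃ u G, MemD12 Ω u G ∧ Nontrivial Ω u ∧ q = quotient Ω a u G}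

/-- `μ*(Ω)` is attained in `D^{1,2}(Ω)`. -/
def AttainedInD12 {N n : ℕ} (Ω : Opens (E N)) (a : Fin n → E N) : Prop :=
  ∃ u G, MemD12 Ω u G ∧ Nontrivial Ω u ∧ quotient Ω a u G = hardyConstant Ω a

/-- `μ*(Ω)` is attained in `H¹₀(Ω)`. -/
def AttainedInH10 {N n : ℕ} (Ω : Opens (E N)) (a : Fin n → E N) : Prop :=
  ∃ u G, MemH10 Ω u G ∧ Nontrivial Ω u ∧ quotient Ω a u G = hardyConstant Ω a

/-- The open ball of center `x₀` and radius `r`. -/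
def ballDomain {N : ℕ} (x₀ : E N) (r : ℝ) : Opens (E N) :=
  ⟨Metric.ball x₀ r, Metric.isOpen_ball⟩

/-- The exterior `{x : |x - x₀| > r}` of a ball. -/
def exteriorDomain {N : ℕ} (x₀ : E N) (r : ℝ) : Opens (E N) :=
  ⟨(Metric.closedBall x₀ r)ᶜ, Metric.isClosed_closedBall.isOpen_compl⟩

/-- The open half-space `{x : ⟨α, x⟩ > b}`; the upper half-space is `α = (0, …, 0, 1)`, `b = 0`. -/
def halfSpaceDomain {N : ℕ} (α : E N) (b : ℝ) : Opens (E N) :=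
  ⟨{x | b < inner ℝ α x}, isOpen_lt continuous_const (by fun_prop)⟩

end MultipolarHardy

end

noncomputable section

namespace MultipolarHardy

variable {N n : ℕ}

/-! Each of the three kinds of domain is {h > 0} for some h(x) = κ|x|² + ⟨ℓ, x⟩ + c that vanishes at
the poles: κ = -1 for a ball, 1 for an exterior, 0 for a half-space. With β = N/n, the function φ =
h ∏ |x - a_i|^(-β) is a positive solution of -Δφ = β² V φ. In terms of b = ∇φ/φ = ∇h/h - β ∑ v_i,
where v_i = (x - a_i)/|x - a_i|², this is the Riccati equation div b + |b|² = -β² V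
(`PoleData.isRiccatiField`). It rests on two identities: ⟨∇h(x), x - a_i⟩ = h(x) + κ|x - a_i|²,
which makes the terms in κ cancel because βn = N, and V = n ∑ |v_i|² - |∑ v_i|².

Lower bound: integrating div(ψ² b) gives ∫|∇ψ|² = ∫|∇ψ - ψb|² + β² ∫Vψ² for test functions
(`IsRiccatiField.lintegral_gradient`). Fatou's lemma extends it as an inequality to D^{1,2}
(`IsRiccatiField.lintegral_le_of_memD12`), hence μ* ≥ β².

Upper bound: φ is truncated to u_ε = χ(ε log d + 2) φ with d = h/(1 + |x|²)², where χ is a smooth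
step. The remainder becomes ∫ φ²|∇(χ(ε log d + 2))|². If t is the distance to the nearest pole, φ²|∇
log d|² is at most a multiple of t^(-N), the borderline singularity. The logarithmic cut-off gains
ε² from the chain rule and loses 1/ε in the integral, so the remainder is O(ε)
(`PoleData.exists_lintegral_remainder_le`), while ∫Vu_ε² stays away from 0.

Attainment: near a pole Vφ² is at most a multiple of t^(-2β), which is integrable when 2β < N, that
is n ≥ 3. The truncations then converge to φ in the gradient norm and φ is a minimizer. On a ball V
is bounded below, so φ is also in L² and in H¹₀.

For two poles on a ball, a minimizer u has zero remainder, so ∇u = ub and u/φ has vanishing weak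
gradient; thus u = cφ. But ∫Vφ² = ∞ (`PoleData.lintegral_groundState_eq_top`), while a minimizer has
finite ∫Vu². -/

/-! ### Test functions, integration by parts and weak gradients -/

theorem contDiff_of_contDiffOn_of_eq_zero {F : Type*} [NormedAddCommGroup F] [NormedSpace ℝ F]
    {m : WithTop ℕ∞} {Ω K : Set (E N)} (hΩ : IsOpen Ω) {f : E N → F} (hf : ContDiffOn ℝ m f Ω)
    (hK : IsClosed K) (hKΩ : K ⊆ Ω) (h0 : ∀ x, x ∉ K → f x = 0) : ContDiff ℝ m f := by
  rw [contDiff_iff_contDiffAt]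
  intro x
  by_cases hx : x ∈ K
  · exact hf.contDiffAt (hΩ.mem_nhds (hKΩ hx))
  · refine contDiffAt_const (c := (0 : F)) |>.congr_of_eventuallyEq ?_
    filter_upwards [hK.isOpen_compl.mem_nhds hx] with y hy using h0 y hy

/-- A smooth function on `Ω` that vanishes off a compact subset of `Ω`, as a test function. -/
def testOf (Ω : Opens (E N)) (f : E N → ℝ) (hf : ContDiffOn ℝ ∞ f Ω) (K : Set (E N))
    (hK : IsCompact K) (hKΩ : K ⊆ Ω) (h0 : ∀ x, x ∉ K → f x = 0) : TestFunction Ω ℝ ⊤ where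
  toFun := f
  contDiff' := contDiff_of_contDiffOn_of_eq_zero Ω.isOpen hf hK.isClosed hKΩ h0
  hasCompactSupport' := HasCompactSupport.intro hK h0
  tsupport_subset' := (closure_minimal
    (fun x hx => by by_contra h; exact hx (h0 x h)) hK.isClosed).trans hKΩ

@[simp] theorem testOf_apply (Ω : Opens (E N)) (f : E N → ℝ) (hf : ContDiffOn ℝ ∞ f Ω)
    (K : Set (E N)) (hK : IsCompact K) (hKΩ : K ⊆ Ω) (h0 : ∀ x, x ∉ K → f x = 0) (x : E N) :
    testOf Ω f hf K hK hKΩ h0 x = f x := rfl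

theorem testFunction_contDiff {Ω : Opens (E N)} (ψ : TestFunction Ω ℝ ⊤) : ContDiff ℝ ∞ ψ :=
  ψ.contDiff

theorem testFunction_eq_zero {Ω : Opens (E N)} (ψ : TestFunction Ω ℝ ⊤) {x : E N}
    (hx : x ∉ tsupport ψ) : ψ x = 0 := image_eq_zero_of_notMem_tsupport hx

theorem testFunction_hasGradientAt {Ω : Opens (E N)} (ψ : TestFunction Ω ℝ ⊤) (x : E N) :
    HasGradientAt ψ (gradient ψ x) x :=
  ((testFunction_contDiff ψ).differentiable (by simp) x).hasGradientAt

theorem continuous_gradient {f : E N → ℝ} (hf : ContDiff ℝ 1 f) : Continuous (gradient f) :=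
  (InnerProductSpace.toDual ℝ (E N)).symm.continuous.comp (hf.continuous_fderiv (by simp))

theorem testFunction_continuous_gradient {Ω : Opens (E N)} (ψ : TestFunction Ω ℝ ⊤) :
    Continuous (gradient ψ) :=
  continuous_gradient ((testFunction_contDiff ψ).of_le (by simp))

theorem testFunction_gradient_eq_zero {Ω : Opens (E N)} (ψ : TestFunction Ω ℝ ⊤) {x : E N}
    (hx : x ∉ tsupport ψ) : gradient ψ x = 0 := by
  have : fderiv ℝ ψ x = 0 := by
    by_contra h
    exact hx (support_fderiv_subset ℝ h)
  simp [gradient, this]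

/-- A continuous function on `Ω` that vanishes off a compact subset of `Ω` is continuous. -/
theorem continuous_of_continuousOn_of_eq_zero {F : Type*} [TopologicalSpace F] [Zero F]
    {Ω K : Set (E N)} (hΩ : IsOpen Ω) {f : E N → F} (hf : ContinuousOn f Ω)
    (hK : IsClosed K) (hKΩ : K ⊆ Ω) (h0 : ∀ x, x ∉ K → f x = 0) : Continuous f := by
  rw [continuous_iff_continuousAt]
  intro x
  by_cases hx : x ∈ K
  · exact hf.continuousAt (hΩ.mem_nhds (hKΩ hx))
  · refine (continuousAt_const (y := (0 : F))).congr ?_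
    filter_upwards [hK.isOpen_compl.mem_nhds hx] with y hy using (h0 y hy).symm

theorem integrable_of_continuousOn_of_eq_zero {F : Type*} [NormedAddCommGroup F]
    {Ω K : Set (E N)} (hΩ : IsOpen Ω) {f : E N → F} (hf : ContinuousOn f Ω)
    (hK : IsCompact K) (hKΩ : K ⊆ Ω) (h0 : ∀ x, x ∉ K → f x = 0) : Integrable f :=
  (continuous_of_continuousOn_of_eq_zero hΩ hf hK.isClosed hKΩ h0).integrable_of_hasCompactSupport
    (HasCompactSupport.intro hK h0)

theorem integral_fderiv_eq_zero {f : E N → ℝ} (hf : ContDiff ℝ 1 f) (hc : HasCompactSupport f)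
    (v : E N) : ∫ x, fderiv ℝ f x v = 0 := by
  have h1 : Continuous fun x => fderiv ℝ f x v :=
    (hf.continuous_fderiv (by simp)).clm_apply continuous_const
  have h2 : HasCompactSupport fun x => fderiv ℝ f x v := hc.fderiv_apply ℝ v
  -- Integration by parts against the constant function 1.
  have := integral_mul_fderiv_eq_neg_fderiv_mul_of_integrable (𝕜 := ℝ) (μ := (volume : Measure (E N)))
    (f := fun _ => (1 : ℝ)) (g := f) (v := v) (by simp)
    (by simpa using h1.integrable_of_hasCompactSupport h2)
    (by simpa using hf.continuous.integrable_of_hasCompactSupport hc)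
    (fun x _ => differentiableAt_const _) (fun x _ => hf.differentiable (by simp) x)
  simpa using this

/-- The trace of an endomorphism, in the standard basis. -/
def euclideanTrace (L : E N →L[ℝ] E N) : ℝ :=
  ∑ i, inner ℝ (EuclideanSpace.basisFun (Fin N) ℝ i) (L (EuclideanSpace.basisFun (Fin N) ℝ i))

theorem integral_divergence_eq_zero {F : E N → E N} (hF : ContDiff ℝ 1 F)
    (hc : HasCompactSupport F) : ∫ x, euclideanTrace (fderiv ℝ F x) = 0 := by
  have key : ∀ (u v : E N), Integrable (fun x => inner ℝ u (fderiv ℝ F x v)) ∧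
      ∫ x, inner ℝ u (fderiv ℝ F x v) = 0 := by
    intro u v
    have hcd : ContDiff ℝ 1 fun x => inner ℝ u (F x) := contDiff_const.inner ℝ hF
    have hcs : HasCompactSupport fun x => inner ℝ u (F x) :=
      hc.comp_left (g := fun y => inner ℝ u y) (by simp)
    have he : ∀ x, fderiv ℝ (fun x => inner ℝ u (F x)) x v = inner ℝ u (fderiv ℝ F x v) := by
      intro x
      have h := ((innerSL ℝ u).hasFDerivAt.comp x
        (hF.differentiable (by simp) x).hasFDerivAt).fderiv
      have h' : fderiv ℝ (fun x => inner ℝ u (F x)) x = (innerSL ℝ u).comp (fderiv ℝ F x) := h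
      rw [h']; simp
    refine ⟨?_, ?_⟩
    · have h1 : Continuous fun x => fderiv ℝ F x v :=
        (hF.continuous_fderiv (by simp)).clm_apply continuous_const
      have h2 : HasCompactSupport fun x => fderiv ℝ F x v := hc.fderiv_apply ℝ v
      exact (continuous_const.inner h1).integrable_of_hasCompactSupport
        (h2.comp_left (g := fun y => inner ℝ u y) (by simp))
    · simp_rw [← he]
      exact integral_fderiv_eq_zero hcd hcs v
  unfold euclideanTrace
  rw [integral_finsetSum _ fun i _ => (key _ _).1]
  exact Finset.sum_eq_zero fun i _ => (key _ _).2

theorem integral_gradient_eq_zero {f : E N → ℝ} (hf : ContDiff ℝ 1 f) (hc : HasCompactSupport f) :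
    ∫ x, gradient f x = 0 := by
  have h2 : HasCompactSupport (gradient f) :=
    (hc.fderiv ℝ).comp_left (g := (InnerProductSpace.toDual ℝ (E N)).symm) (map_zero _)
  have hi : Integrable (gradient f) := (continuous_gradient hf).integrable_of_hasCompactSupport h2
  refine ext_inner_left ℝ fun v => ?_
  rw [inner_zero_right, ← integral_inner hi]
  have : ∀ x, inner ℝ v (gradient f x) = fderiv ℝ f x v := by
    intro x
    rw [real_inner_comm, gradient, InnerProductSpace.toDual_symm_apply]
  simp_rw [this]
  exact integral_fderiv_eq_zero hf hc v

theorem hasGradientAt_mul {f g : E N → ℝ} {f' g' x : E N} (hf : HasGradientAt f f' x)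
    (hg : HasGradientAt g g' x) :
    HasGradientAt (fun y => f y * g y) (f x • g' + g x • f') x := by
  rw [hasGradientAt_iff_hasFDerivAt] at *
  exact (hf.mul hg).congr_fderiv (by ext v; simp)

/-- The gradient of `f ∘ g` for a real function `f` of a real variable. -/
theorem hasGradientAt_comp {g : E N → ℝ} {g' x : E N} {f : ℝ → ℝ} {f' : ℝ}
    (hf : HasDerivAt f f' (g x)) (hg : HasGradientAt g g' x) :
    HasGradientAt (fun y => f (g y)) (f' • g') x := by
  rw [hasGradientAt_iff_hasFDerivAt] at *
  exact (hf.comp_hasFDerivAt x hg).congr_fderiv (by ext v; simp)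

theorem hasGradientAt_add {f g : E N → ℝ} {f' g' x : E N} (hf : HasGradientAt f f' x)
    (hg : HasGradientAt g g' x) : HasGradientAt (fun y => f y + g y) (f' + g') x := by
  rw [hasGradientAt_iff_hasFDerivAt] at *
  exact (hf.add hg).congr_fderiv (by ext v; simp)

theorem continuousOn_gradient {Ω : Set (E N)} (hΩ : IsOpen Ω) {f : E N → ℝ} {G : E N → E N}
    (hf : ContDiffOn ℝ ∞ f Ω) (hG : ∀ x ∈ Ω, HasGradientAt f (G x) x) : ContinuousOn G Ω := by
  have h := hf.continuousOn_fderiv_of_isOpen hΩ (by simp)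
  refine ((InnerProductSpace.toDual ℝ (E N)).symm.continuous.comp_continuousOn h).congr ?_
  intro x hx
  exact (hG x hx).gradient.symm

/-- The product ψf extends by zero to a global test function even if f is singular at the boundary;
its gradient has integral zero, and the product rule splits that integral. -/
theorem isWeakGradient_of_contDiffOn {Ω : Opens (E N)} {f : E N → ℝ} {G : E N → E N}
    (hf : ContDiffOn ℝ ∞ f Ω) (hG : ∀ x ∈ Ω, HasGradientAt f (G x) x) :
    IsWeakGradient Ω f G := by
  intro ψ
  have hGc : ContinuousOn G Ω := continuousOn_gradient Ω.isOpen hf hG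
  have hK : IsCompact (tsupport ψ) := ψ.hasCompactSupport
  have hP : ContDiffOn ℝ ∞ (fun x => ψ x * f x) Ω := (testFunction_contDiff ψ).contDiffOn.mul hf
  let P := testOf Ω (fun x => ψ x * f x) hP (tsupport ψ) hK ψ.tsupport_subset
    (fun x hx => by simp [testFunction_eq_zero ψ hx])
  have hgP : ∀ x, gradient P x = f x • gradient ψ x + ψ x • G x := by
    intro x
    by_cases hx : x ∈ tsupport ψ
    · have := hasGradientAt_mul (testFunction_hasGradientAt ψ x) (hG x (ψ.tsupport_subset hx))
      rw [add_comm]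
      exact this.gradient
    · rw [testFunction_gradient_eq_zero ψ hx, testFunction_eq_zero ψ hx]
      simp only [smul_zero, zero_smul, add_zero]
      apply testFunction_gradient_eq_zero P
      refine fun h => hx (closure_minimal ?_ (isClosed_tsupport ψ) h)
      intro y hy
      by_contra h'
      exact hy (by simp [P, testFunction_eq_zero ψ h'])
  have i1 : Integrable fun x => f x • gradient ψ x :=
    integrable_of_continuousOn_of_eq_zero Ω.isOpen
      (hf.continuousOn.smul (testFunction_continuous_gradient ψ).continuousOn) hK ψ.tsupport_subset
      (fun x hx => by simp [testFunction_gradient_eq_zero ψ hx])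
  have i2 : Integrable fun x => ψ x • G x :=
    integrable_of_continuousOn_of_eq_zero Ω.isOpen
      (ψ.continuous.continuousOn.smul hGc) hK ψ.tsupport_subset
      (fun x hx => by simp [testFunction_eq_zero ψ hx])
  have h0 := integral_gradient_eq_zero ((testFunction_contDiff P).of_le (by simp))
    P.hasCompactSupport
  simp_rw [hgP] at h0
  rw [integral_add i1 i2] at h0
  rw [setIntegral_eq_integral_of_forall_compl_eq_zero, setIntegral_eq_integral_of_forall_compl_eq_zero]
  · exact eq_neg_of_add_eq_zero_left h0
  · intro x hx
    simp [testFunction_eq_zero ψ fun h => hx (ψ.tsupport_subset h)]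
  · intro x hx
    simp [testFunction_gradient_eq_zero ψ fun h => hx (ψ.tsupport_subset h)]

/-! ### Traces, Riccati fields and the ground state representation -/

theorem euclideanTrace_add (L M : E N →L[ℝ] E N) :
    euclideanTrace (L + M) = euclideanTrace L + euclideanTrace M := by
  simp only [euclideanTrace, add_apply, inner_add_right, Finset.sum_add_distrib]

theorem euclideanTrace_smul (t : ℝ) (L : E N →L[ℝ] E N) :
    euclideanTrace (t • L) = t * euclideanTrace L := by
  simp only [euclideanTrace, smul_apply, inner_smul_right, Finset.mul_sum]

theorem euclideanTrace_sum {ι : Type*} (s : Finset ι) (L : ι → E N →L[ℝ] E N) :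
    euclideanTrace (∑ j ∈ s, L j) = ∑ j ∈ s, euclideanTrace (L j) := by
  classical
  induction s using Finset.induction_on with
  | empty => simp [euclideanTrace]
  | insert j s hj ih => rw [Finset.sum_insert hj, Finset.sum_insert hj, euclideanTrace_add, ih]

theorem euclideanTrace_id : euclideanTrace (ContinuousLinearMap.id ℝ (E N)) = N := by
  simp [euclideanTrace]

theorem euclideanTrace_smulRight (u v : E N) :
    euclideanTrace ((InnerProductSpace.toDual ℝ (E N) u).smulRight v) = inner ℝ u v := by
  unfold euclideanTrace
  rw [← (EuclideanSpace.basisFun (Fin N) ℝ).sum_inner_mul_inner u v]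
  refine Finset.sum_congr rfl fun i _ => ?_
  rw [ContinuousLinearMap.smulRight_apply, InnerProductSpace.toDual_apply_apply, inner_smul_right]

/-- `b` is the logarithmic gradient of a positive solution of `-Δφ = W φ` in `Ω`, expressed by the
Riccati equation `div b + |b|² = -W`. -/
structure IsRiccatiField (Ω : Opens (E N)) (b : E N → E N) (W : E N → ℝ) : Prop where
  contDiffOn : ContDiffOn ℝ ∞ b Ω
  continuousOn : ContinuousOn W Ω
  nonneg : ∀ x ∈ Ω, 0 ≤ W x
  riccati : ∀ x ∈ Ω, euclideanTrace (fderiv ℝ b x) + ‖b x‖ ^ 2 = - W x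

namespace IsRiccatiField

variable {Ω : Opens (E N)} {b : E N → E N} {W : E N → ℝ}

/-- The ground state representation of the Dirichlet integral of a test function. -/
theorem lintegral_gradient (h : IsRiccatiField Ω b W) (ψ : TestFunction Ω ℝ ⊤) :
    ∫⁻ x in (Ω : Set (E N)), ENNReal.ofReal (‖gradient ψ x‖ ^ 2) =
      ∫⁻ x in (Ω : Set (E N)), ENNReal.ofReal (‖gradient ψ x - ψ x • b x‖ ^ 2 + W x * ψ x ^ 2) := by
  have hK : IsCompact (tsupport ψ) := ψ.hasCompactSupport
  have hKΩ : tsupport ψ ⊆ Ω := ψ.tsupport_subset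
  -- The divergence of ψ² b is 2ψ⟨∇ψ, b⟩ + ψ² div b. Eliminating div b by the Riccati equation and
  -- completing the square shows that the two integrands differ by exactly this divergence.
  let F : E N → E N := fun x => ψ x ^ 2 • b x
  have hF0 : ∀ x, x ∉ tsupport ψ → F x = 0 := fun x hx => by simp [F, testFunction_eq_zero ψ hx]
  have hF : ContDiff ℝ 1 F := by
    refine (contDiff_of_contDiffOn_of_eq_zero Ω.isOpen (m := ∞) ?_ hK.isClosed hKΩ hF0).of_le
      (by simp)
    exact ((testFunction_contDiff ψ).pow 2).contDiffOn.smul h.contDiffOn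
  have hFc : HasCompactSupport F := HasCompactSupport.intro hK hF0
  have hpt : ∀ x, ‖gradient ψ x‖ ^ 2 =
      (‖gradient ψ x - ψ x • b x‖ ^ 2 + W x * ψ x ^ 2) + euclideanTrace (fderiv ℝ F x) := by
    intro x
    by_cases hx : x ∈ tsupport ψ
    · have hxΩ : x ∈ Ω := hKΩ hx
      have hb : HasFDerivAt b (fderiv ℝ b x) x :=
        ((h.contDiffOn.contDiffAt (Ω.isOpen.mem_nhds hxΩ)).differentiableAt (by simp)).hasFDerivAt
      have hψ := testFunction_hasGradientAt ψ x
      have hψ2 : HasFDerivAt (fun y => ψ y ^ 2)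
          ((2 * ψ x) • InnerProductSpace.toDual ℝ (E N) (gradient ψ x)) x := by
        rw [hasGradientAt_iff_hasFDerivAt] at hψ
        exact (hψ.pow 2).congr_fderiv (by ext v; simp)
      have hFd : fderiv ℝ F x = ψ x ^ 2 • fderiv ℝ b x +
          (2 * ψ x) • (InnerProductSpace.toDual ℝ (E N) (gradient ψ x)).smulRight (b x) := by
        refine ((hψ2.smul hb).congr_fderiv ?_).fderiv
        ext v
        simp [mul_smul]
      rw [hFd, euclideanTrace_add, euclideanTrace_smul, euclideanTrace_smul,
        euclideanTrace_smulRight, norm_sub_sq_real, norm_smul, inner_smul_right, mul_pow,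
        Real.norm_eq_abs, sq_abs]
      have := h.riccati x hxΩ
      linear_combination (- ψ x ^ 2) * this
    · have hFd : fderiv ℝ F x = 0 := by
        by_contra hne
        refine hx (closure_minimal ?_ (isClosed_tsupport ψ) (support_fderiv_subset ℝ hne))
        intro y hy
        by_contra h'
        exact hy (hF0 y h')
      simp [testFunction_gradient_eq_zero ψ hx, testFunction_eq_zero ψ hx, hFd, euclideanTrace]
  have hg := testFunction_continuous_gradient ψ
  have c2 : ContinuousOn (fun x => ‖gradient ψ x - ψ x • b x‖ ^ 2 + W x * ψ x ^ 2) Ω :=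
    ((hg.continuousOn.sub (ψ.continuous.continuousOn.smul h.contDiffOn.continuousOn)).norm.pow 2).add
      (h.continuousOn.mul (ψ.continuous.continuousOn.pow 2))
  have z2 : ∀ x, x ∉ tsupport ψ → ‖gradient ψ x - ψ x • b x‖ ^ 2 + W x * ψ x ^ 2 = 0 :=
    fun x hx => by simp [testFunction_gradient_eq_zero ψ hx, testFunction_eq_zero ψ hx]
  have z1 : ∀ x, x ∉ tsupport ψ → ‖gradient ψ x‖ ^ 2 = 0 :=
    fun x hx => by simp [testFunction_gradient_eq_zero ψ hx]
  have i1 := integrable_of_continuousOn_of_eq_zero Ω.isOpen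
    (f := fun x => ‖gradient ψ x‖ ^ 2) (hg.norm.pow 2).continuousOn hK hKΩ z1
  have i2 := integrable_of_continuousOn_of_eq_zero Ω.isOpen c2 hK hKΩ z2
  have i3 : Integrable fun x => euclideanTrace (fderiv ℝ F x) := by
    refine (i1.sub i2).congr (ae_of_all _ fun x => ?_)
    have := hpt x
    simp only [Pi.sub_apply]
    linarith
  have heq : ∫ x, ‖gradient ψ x‖ ^ 2 =
      ∫ x, (‖gradient ψ x - ψ x • b x‖ ^ 2 + W x * ψ x ^ 2) := by
    rw [integral_congr_ae (ae_of_all _ hpt), integral_add i2 i3,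
      integral_divergence_eq_zero hF hFc, add_zero]
  rw [← ofReal_integral_eq_lintegral_ofReal i1.restrict (ae_of_all _ fun x => by positivity),
    ← ofReal_integral_eq_lintegral_ofReal i2.restrict,
    setIntegral_eq_integral_of_forall_compl_eq_zero fun x hx => z1 x fun h' => hx (hKΩ h'),
    setIntegral_eq_integral_of_forall_compl_eq_zero fun x hx => z2 x fun h' => hx (hKΩ h'), heq]
  refine (ae_restrict_mem Ω.isOpen.measurableSet).mono fun x hx => ?_
  have := h.nonneg x hx
  simp only [Pi.zero_apply]
  positivity

end IsRiccatiField

/-! ### The Hardy inequality with remainder on D^{1,2} -/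

theorem eLpNorm_two_sq {α F : Type*} [MeasurableSpace α] [NormedAddCommGroup F] (μ : Measure α)
    (f : α → F) : eLpNorm f 2 μ ^ 2 = ∫⁻ x, ENNReal.ofReal (‖f x‖ ^ 2) ∂μ := by
  have := eLpNorm_nnreal_pow_eq_lintegral (f := f) (μ := μ) (p := 2) (by simp)
  simp only [NNReal.coe_ofNat, ENNReal.coe_ofNat, ENNReal.rpow_ofNat] at this
  rw [this]
  refine lintegral_congr fun x => ?_
  rw [ENNReal.ofReal_pow (norm_nonneg _), ofReal_norm]

/-- An exhaustion of an open set by compact sets. -/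
theorem exists_compact_exhaustion (Ω : Opens (E N)) :
    ∃ K : ℕ → Set (E N), Monotone K ∧ (∀ m, IsCompact (K m)) ∧ ⋃ m, K m = Ω := by
  have : LocallyCompactSpace Ω := Ω.isOpen.locallyCompactSpace
  have : SigmaCompactSpace Ω := sigmaCompactSpace_of_locallyCompact_secondCountable
  let C := CompactExhaustion.choice Ω
  refine ⟨fun m => (↑) '' C m, fun i j hij => Set.image_mono (C.subset hij),
    fun m => (C.isCompact m).image continuous_subtype_val, ?_⟩
  rw [← Set.image_iUnion, C.iUnion_eq, Set.image_univ]
  exact Subtype.range_coe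

namespace IsRiccatiField

variable {Ω : Opens (E N)} {b : E N → E N} {W : E N → ℝ}

/-- Fatou's lemma along the approximating test functions, for which the ground state representation
is an equality. A compact K is needed because the approximants converge to u only in L²_loc. -/
theorem lintegral_le_of_memD12_aux (h : IsRiccatiField Ω b W) {u : E N → ℝ} {G : E N → E N}
    (hu : MemD12 Ω u G) {K : Set (E N)} (hK : IsCompact K) (hKΩ : K ⊆ Ω) :
    ∫⁻ x in K, ENNReal.ofReal (‖G x - u x • b x‖ ^ 2 + W x * u x ^ 2) ≤
      ∫⁻ x in (Ω : Set (E N)), ENNReal.ofReal (‖G x‖ ^ 2) := by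
  obtain ⟨φ, h1, h2⟩ := hu.approx
  have hle : volume.restrict K ≤ volume.restrict (Ω : Set (E N)) := Measure.restrict_mono hKΩ le_rfl
  have m1 : TendstoInMeasure (volume.restrict K) (fun k => (φ k : E N → ℝ)) atTop u :=
    tendstoInMeasure_of_tendsto_eLpNorm (p := 2) (by simp)
      (fun k => (φ k).continuous.aestronglyMeasurable) (hu.memLp_loc K hK hKΩ).1 (h1 K hK hKΩ)
  -- Two successive subsequences make the functions, then also their gradients, converge almost
  -- everywhere on K.
  obtain ⟨s, hs, hs'⟩ := m1.exists_seq_tendsto_ae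
  have h2s := h2.comp hs.tendsto_atTop
  have m2 : TendstoInMeasure (volume.restrict K) (fun k => gradient (φ (s k))) atTop G :=
    tendstoInMeasure_of_tendsto_eLpNorm (p := 2) (by simp)
      (fun k => (testFunction_continuous_gradient _).aestronglyMeasurable)
      (hu.memLp_grad.1.mono_measure hle)
      (tendsto_of_tendsto_of_tendsto_of_le_of_le tendsto_const_nhds h2s (fun _ => zero_le)
        fun k => eLpNorm_mono_measure _ hle)
  obtain ⟨r, hr, hr'⟩ := m2.exists_seq_tendsto_ae
  have h2r := h2s.comp hr.tendsto_atTop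
  set θ : ℕ → TestFunction Ω ℝ ⊤ := fun k => φ (s (r k)) with hθ
  have hlim : ∀ᵐ x ∂volume.restrict K, ENNReal.ofReal (‖G x - u x • b x‖ ^ 2 + W x * u x ^ 2) =
      liminf (fun k => ENNReal.ofReal
        (‖gradient (θ k) x - θ k x • b x‖ ^ 2 + W x * θ k x ^ 2)) atTop := by
    filter_upwards [hs', hr'] with x hx1 hx2
    have hx1' := hx1.comp hr.tendsto_atTop
    refine (Tendsto.liminf_eq ?_).symm
    refine ENNReal.tendsto_ofReal ?_
    exact ((hx2.sub (hx1'.smul_const (b x))).norm.pow 2).add ((hx1'.pow 2).const_mul (W x))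
  rw [lintegral_congr_ae hlim]
  refine (lintegral_liminf_le' fun k => ?_).trans ?_
  · refine ContinuousOn.aemeasurable ?_ hK.measurableSet
    refine ENNReal.continuous_ofReal.comp_continuousOn ?_
    exact ((((testFunction_continuous_gradient _).continuousOn.sub
      ((θ k).continuous.continuousOn.smul h.contDiffOn.continuousOn)).norm.pow 2).add
      (h.continuousOn.mul ((θ k).continuous.continuousOn.pow 2))).mono hKΩ
  · have hb : ∀ k, ∫⁻ x in K, ENNReal.ofReal
        (‖gradient (θ k) x - θ k x • b x‖ ^ 2 + W x * θ k x ^ 2) ≤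
        (eLpNorm (fun x => gradient (θ k) x - G x) 2 (volume.restrict Ω) +
          eLpNorm G 2 (volume.restrict Ω)) ^ 2 := by
      intro k
      refine (lintegral_mono_set hKΩ).trans ?_
      rw [← h.lintegral_gradient, ← eLpNorm_two_sq]
      refine pow_le_pow_left' ?_ 2
      have hm : AEStronglyMeasurable (fun x => gradient (θ k) x - G x) (volume.restrict Ω) :=
        (testFunction_continuous_gradient _).aestronglyMeasurable.sub hu.memLp_grad.1
      have := eLpNorm_add_le hm hu.memLp_grad.1 (p := 2) (by norm_num)
      refine le_trans (le_of_eq ?_) this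
      congr 1
      ext1 x
      simp
    have hT : Tendsto (fun k => (eLpNorm (fun x => gradient (θ k) x - G x) 2 (volume.restrict Ω) +
          eLpNorm G 2 (volume.restrict Ω)) ^ 2) atTop (𝓝 ((0 + eLpNorm G 2 (volume.restrict Ω)) ^ 2)) :=
      (ENNReal.continuous_pow 2).tendsto _ |>.comp (h2r.add tendsto_const_nhds)
    rw [← eLpNorm_two_sq]
    refine (liminf_le_liminf (Eventually.of_forall hb)).trans ?_
    rw [hT.liminf_eq, zero_add]

/-- The Hardy inequality with remainder. -/
theorem lintegral_le_of_memD12 (h : IsRiccatiField Ω b W) {u : E N → ℝ} {G : E N → E N}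
    (hu : MemD12 Ω u G) :
    ∫⁻ x in (Ω : Set (E N)), ENNReal.ofReal (‖G x - u x • b x‖ ^ 2 + W x * u x ^ 2) ≤
      ∫⁻ x in (Ω : Set (E N)), ENNReal.ofReal (‖G x‖ ^ 2) := by
  obtain ⟨K, hKm, hKc, hKU⟩ := exists_compact_exhaustion Ω
  have hK : ∀ m, K m ⊆ Ω := fun m => hKU ▸ Set.subset_iUnion K m
  conv_lhs => rw [← hKU]
  rw [setLIntegral_iUnion_of_directed _ (directed_of_isDirected_le hKm)]
  exact iSup_le fun m => h.lintegral_le_of_memD12_aux hu (hKc m) (hK m)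

end IsRiccatiField

theorem MemH10.memD12 {Ω : Opens (E N)} {u : E N → ℝ} {G : E N → E N} (h : MemH10 Ω u G) :
    MemD12 Ω u G where
  aestronglyMeasurable := h.memLp.1
  memLp_loc K _ hK := h.memLp.mono_measure (Measure.restrict_mono hK le_rfl)
  memLp_grad := h.memLp_grad
  weakGradient := h.weakGradient
  approx := by
    obtain ⟨φ, h1, h2⟩ := h.approx
    refine ⟨φ, fun K _ hK => ?_, h2⟩
    exact tendsto_of_tendsto_of_tendsto_of_le_of_le tendsto_const_nhds h1 (fun _ => zero_le)
      fun k => eLpNorm_mono_measure _ (Measure.restrict_mono hK le_rfl)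

theorem memD12_testFunction {Ω : Opens (E N)} (ψ : TestFunction Ω ℝ ⊤) :
    MemD12 Ω ψ (gradient ψ) where
  aestronglyMeasurable := ψ.continuous.aestronglyMeasurable
  memLp_loc K _ _ := (ψ.continuous.memLp_of_hasCompactSupport ψ.hasCompactSupport).restrict K
  memLp_grad := by
    refine ((testFunction_continuous_gradient ψ).memLp_of_hasCompactSupport (μ := volume) ?_).restrict Ω
    exact HasCompactSupport.intro ψ.hasCompactSupport
      fun x hx => testFunction_gradient_eq_zero ψ hx
  weakGradient := isWeakGradient_of_contDiffOn (testFunction_contDiff ψ).contDiffOn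
    fun x _ => testFunction_hasGradientAt ψ x
  approx := ⟨fun _ => ψ, by simp, by simp⟩

/-! ### Divergence calculus, inversions and identities for pairs -/

/-- `F` is differentiable at `x` with divergence `d`. -/
def HasDivergenceAt (F : E N → E N) (d : ℝ) (x : E N) : Prop :=
  ∃ L : E N →L[ℝ] E N, HasFDerivAt F L x ∧ euclideanTrace L = d

theorem HasDivergenceAt.eq {F : E N → E N} {d : ℝ} {x : E N} (h : HasDivergenceAt F d x) :
    euclideanTrace (fderiv ℝ F x) = d := by
  obtain ⟨L, hL, rfl⟩ := h
  rw [hL.fderiv]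

theorem HasDivergenceAt.add {F G : E N → E N} {d e : ℝ} {x : E N} (hF : HasDivergenceAt F d x)
    (hG : HasDivergenceAt G e x) : HasDivergenceAt (fun y => F y + G y) (d + e) x := by
  obtain ⟨L, hL, rfl⟩ := hF
  obtain ⟨M, hM, rfl⟩ := hG
  exact ⟨L + M, hL.add hM, euclideanTrace_add _ _⟩

theorem HasDivergenceAt.const_smul {F : E N → E N} {d : ℝ} {x : E N} (hF : HasDivergenceAt F d x)
    (t : ℝ) : HasDivergenceAt (fun y => t • F y) (t * d) x := by
  obtain ⟨L, hL, rfl⟩ := hF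
  exact ⟨t • L, hL.const_smul t, euclideanTrace_smul _ _⟩

theorem HasDivergenceAt.sum {ι : Type*} (s : Finset ι) {F : ι → E N → E N} {d : ι → ℝ} {x : E N}
    (hF : ∀ i, HasDivergenceAt (F i) (d i) x) :
    HasDivergenceAt (fun y => ∑ i ∈ s, F i y) (∑ i ∈ s, d i) x := by
  choose L hL hd using hF
  refine ⟨∑ i ∈ s, L i, HasFDerivAt.fun_sum fun i _ => hL i, ?_⟩
  rw [euclideanTrace_sum]
  exact Finset.sum_congr rfl fun i _ => hd i

theorem HasDivergenceAt.smul {f : E N → ℝ} {F : E N → E N} {f' : E N} {d : ℝ} {x : E N}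
    (hf : HasGradientAt f f' x) (hF : HasDivergenceAt F d x) :
    HasDivergenceAt (fun y => f y • F y) (f x * d + inner ℝ f' (F x)) x := by
  obtain ⟨L, hL, rfl⟩ := hF
  rw [hasGradientAt_iff_hasFDerivAt] at hf
  exact ⟨_, hf.smul hL, by rw [euclideanTrace_add, euclideanTrace_smul, euclideanTrace_smulRight]⟩

theorem hasDivergenceAt_sub_const (p x : E N) : HasDivergenceAt (fun y => y - p) N x :=
  ⟨_, (hasFDerivAt_id x).sub_const p, euclideanTrace_id⟩

theorem hasGradientAt_norm_sub_sq (p x : E N) :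
    HasGradientAt (fun y => ‖y - p‖ ^ 2) ((2 : ℝ) • (x - p)) x := by
  rw [hasGradientAt_iff_hasFDerivAt]
  refine ((hasFDerivAt_id x).sub_const p).norm_sq.congr_fderiv ?_
  ext v
  simp

/-- The inversion `(x - p) / |x - p|²` centered at `p`. -/
def inversionField (p x : E N) : E N := (‖x - p‖ ^ 2)⁻¹ • (x - p)

theorem norm_inversionField_sq (p x : E N) : ‖inversionField p x‖ ^ 2 = (‖x - p‖ ^ 2)⁻¹ := by
  rw [inversionField, norm_smul, mul_pow, norm_inv, norm_pow, norm_norm]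
  by_cases h : ‖x - p‖ = 0
  · simp [h]
  · field_simp

theorem hasDivergenceAt_inversionField {p x : E N} (hx : x ≠ p) :
    HasDivergenceAt (inversionField p) ((N - 2) * (‖x - p‖ ^ 2)⁻¹) x := by
  have h0 : ‖x - p‖ ≠ 0 := norm_ne_zero_iff.2 (sub_ne_zero.2 hx)
  have h0' : ‖x - p‖ ^ 2 ≠ 0 := pow_ne_zero 2 h0
  have := HasDivergenceAt.smul (hasGradientAt_comp (hasDerivAt_inv h0')
    (hasGradientAt_norm_sub_sq p x)) (hasDivergenceAt_sub_const p x)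
  have hd : (N - 2) * (‖x - p‖ ^ 2)⁻¹ = (‖x - p‖ ^ 2)⁻¹ * (N : ℝ) +
      inner ℝ (-((‖x - p‖ ^ 2) ^ 2)⁻¹ • (2 : ℝ) • (x - p)) (x - p) := by
    rw [inner_smul_left, inner_smul_left, real_inner_self_eq_norm_sq]
    simp only [conj_trivial]
    field_simp
    ring
  rw [hd]
  exact this

/-- This is the distance formula for inversion, seen from x: expand both squares after writing p - q
= (x - q) - (x - p). It identifies each summand of V with |v_i - v_j|². -/
theorem norm_inversionField_sub_sq {p q x : E N} (hp : x ≠ p) (hq : x ≠ q) :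
    ‖inversionField p x - inversionField q x‖ ^ 2 =
      ‖p - q‖ ^ 2 / (‖x - p‖ ^ 2 * ‖x - q‖ ^ 2) := by
  have h1 : ‖x - p‖ ≠ 0 := norm_ne_zero_iff.2 (sub_ne_zero.2 hp)
  have h2 : ‖x - q‖ ≠ 0 := norm_ne_zero_iff.2 (sub_ne_zero.2 hq)
  have h3 : p - q = (x - q) - (x - p) := by abel
  rw [h3, norm_sub_sq_real, norm_sub_sq_real, norm_inversionField_sq, norm_inversionField_sq,
    inversionField, inversionField, inner_smul_left, inner_smul_right,
    real_inner_comm (x - p) (x - q)]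
  simp only [conj_trivial]
  field_simp

theorem two_mul_sum_sum_Ioi (f : Fin n → Fin n → ℝ) (hs : ∀ i j, f i j = f j i)
    (h0 : ∀ i, f i i = 0) : 2 * ∑ i, ∑ j ∈ Finset.Ioi i, f i j = ∑ i, ∑ j, f i j := by
  have h1 : ∑ i, ∑ j ∈ Finset.Iio i, f i j = ∑ i, ∑ j ∈ Finset.Ioi i, f i j := by
    rw [Finset.sum_comm' (t' := Finset.univ) (s' := fun j => Finset.Ioi j) (by simp)]
    exact Finset.sum_congr rfl fun i _ => Finset.sum_congr rfl fun j _ => hs _ _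
  have h2 : ∀ i, ∑ j, f i j = ∑ j ∈ Finset.Iio i, f i j + ∑ j ∈ Finset.Ioi i, f i j := by
    intro i
    rw [← Finset.sum_union]
    · symm
      refine Finset.sum_subset (Finset.subset_univ _) fun j _ hj => ?_
      have : j = i := by
        simp only [Finset.mem_union, Finset.mem_Iio, Finset.mem_Ioi, not_or, not_lt] at hj
        exact le_antisymm hj.2 hj.1
      rw [this, h0]
    · rw [Finset.disjoint_left]
      intro j hj hj'
      exact lt_asymm (Finset.mem_Iio.1 hj) (Finset.mem_Ioi.1 hj')
  simp_rw [h2, Finset.sum_add_distrib, h1]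
  ring

/-- Expanding |v_i - v_j|² over all ordered pairs gives 2n ∑ |v_i|² - 2|∑ v_i|², and each unordered
pair is counted twice. -/
theorem norm_sum_sq_add_sum_Ioi (v : Fin n → E N) :
    ‖∑ i, v i‖ ^ 2 + ∑ i, ∑ j ∈ Finset.Ioi i, ‖v i - v j‖ ^ 2 = n * ∑ i, ‖v i‖ ^ 2 := by
  have h := two_mul_sum_sum_Ioi (fun i j => ‖v i - v j‖ ^ 2) (fun i j => by rw [norm_sub_rev])
    (fun i => by simp)
  have h2 : ‖∑ i, v i‖ ^ 2 = ∑ i, ∑ j, inner ℝ (v i) (v j) := by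
    rw [← real_inner_self_eq_norm_sq, sum_inner]
    exact Finset.sum_congr rfl fun i _ => inner_sum _ _ _
  simp only [norm_sub_sq_real, Finset.sum_add_distrib, Finset.sum_sub_distrib, ← Finset.mul_sum,
    Finset.sum_const, Finset.card_univ, Fintype.card_fin, nsmul_eq_mul, ← h2] at h
  simp only [norm_sub_sq_real]
  have h3 : ∑ i, ∑ j ∈ Finset.Ioi i, (‖v i‖ ^ 2 - 2 * inner ℝ (v i) (v j) + ‖v j‖ ^ 2) =
      ∑ i, (∑ j ∈ Finset.Ioi i, ‖v i‖ ^ 2 - 2 * ∑ j ∈ Finset.Ioi i, inner ℝ (v i) (v j)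
        + ∑ j ∈ Finset.Ioi i, ‖v j‖ ^ 2) := by
    simp only [Finset.sum_add_distrib, Finset.sum_sub_distrib, ← Finset.mul_sum]
  rw [h3]
  simp only [Finset.sum_add_distrib, Finset.sum_sub_distrib, ← Finset.mul_sum, Finset.sum_const,
    nsmul_eq_mul] at h ⊢
  linarith

/-! ### Quadratic regions, the ground state and its Riccati equation -/

/-- A region `{h > 0}` for a function `h x = κ |x|² + ⟨ℓ, x⟩ + c`, with distinct poles on
`{h = 0}`: balls, exteriors of balls and half-spaces are of this kind. -/
structure PoleData (N n : ℕ) where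
  /-- The coefficient of `|x|²`. -/
  curv : ℝ
  /-- The linear part. -/
  lin : E N
  /-- The constant term. -/
  cst : ℝ
  /-- The poles. -/
  pole : Fin n → E N
  injective : Function.Injective pole
  height_pole : ∀ i, curv * ‖pole i‖ ^ 2 + inner ℝ lin (pole i) + cst = 0

namespace PoleData

variable (P : PoleData N n)

/-- The defining function `h` of the region. -/
def height (x : E N) : ℝ := P.curv * ‖x‖ ^ 2 + inner ℝ P.lin x + P.cst

/-- The gradient of `h`. -/
def heightGrad (x : E N) : E N := (2 * P.curv) • x + P.lin

theorem contDiff_height : ContDiff ℝ ∞ P.height := by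
  unfold height
  exact ((contDiff_const.mul (contDiff_norm_sq ℝ)).add
    (contDiff_const.inner ℝ contDiff_id)).add contDiff_const

/-- The region `{h > 0}`. -/
def domain : Opens (E N) :=
  ⟨{x | 0 < P.height x}, isOpen_lt continuous_const P.contDiff_height.continuous⟩

/-- The exponent `N / n`. -/
def expo (_ : PoleData N n) : ℝ := N / n

/-- The weight `∏ |x - a i| ^ (- N / n)`. -/
def weight (x : E N) : ℝ :=
  Real.exp (-(P.expo / 2) * ∑ i, Real.log (‖x - P.pole i‖ ^ 2))

/-- The positive solution of `-Δφ = (N / n)² V φ`. -/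
def groundState (x : E N) : ℝ := P.height x * P.weight x

/-- The logarithmic gradient of the ground state. -/
def logGrad (x : E N) : E N :=
  (P.height x)⁻¹ • P.heightGrad x + (-P.expo) • ∑ i, inversionField (P.pole i) x

variable {P} {x : E N}

theorem mem_domain : x ∈ P.domain ↔ 0 < P.height x := Iff.rfl

theorem ne_pole (hx : x ∈ P.domain) (i : Fin n) : x ≠ P.pole i := by
  rintro rfl
  exact hx.ne' (P.height_pole i)

theorem norm_sub_pole_pos (hx : x ∈ P.domain) (i : Fin n) : 0 < ‖x - P.pole i‖ :=
  norm_pos_iff.2 (sub_ne_zero.2 (ne_pole hx i))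

theorem weight_pos (P : PoleData N n) (x : E N) : 0 < P.weight x := Real.exp_pos _

theorem groundState_pos (hx : x ∈ P.domain) : 0 < P.groundState x :=
  mul_pos hx (P.weight_pos x)

theorem hasGradientAt_height (P : PoleData N n) (x : E N) :
    HasGradientAt P.height (P.heightGrad x) x := by
  have h1 := hasGradientAt_norm_sub_sq (0 : E N) x
  rw [hasGradientAt_iff_hasFDerivAt] at *
  simp only [sub_zero] at h1
  refine (((h1.const_mul P.curv).add (innerSL ℝ P.lin).hasFDerivAt).add_const P.cst).congr_fderiv ?_
  ext v
  simp only [heightGrad, map_smul, map_add, add_apply,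
    smul_apply, InnerProductSpace.toDual_apply_apply, smul_eq_mul,
    innerSL_apply_apply]
  ring

/-- The second-order Taylor expansion of the quadratic h at x is exact; evaluate it at the pole,
where h vanishes. Both the Riccati equation and the linear vanishing of h at the poles come from
this. -/
theorem inner_heightGrad_sub_pole (P : PoleData N n) (x : E N) (i : Fin n) :
    inner ℝ (P.heightGrad x) (x - P.pole i) = P.height x + P.curv * ‖x - P.pole i‖ ^ 2 := by
  have := P.height_pole i
  rw [height, heightGrad, norm_sub_sq_real, inner_add_left, inner_smul_left, inner_sub_right,
    inner_sub_right, real_inner_self_eq_norm_sq]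
  simp only [conj_trivial]
  linarith

theorem hasDivergenceAt_heightGrad (P : PoleData N n) (x : E N) :
    HasDivergenceAt P.heightGrad (2 * P.curv * N) x := by
  refine ⟨(2 * P.curv) • ContinuousLinearMap.id ℝ (E N), ?_, ?_⟩
  · exact ((hasFDerivAt_id x).const_smul (2 * P.curv)).add_const P.lin
  · rw [euclideanTrace_smul, euclideanTrace_id]

theorem potential_eq (hx : x ∈ P.domain) : potential P.pole x =
    n * ∑ i, ‖inversionField (P.pole i) x‖ ^ 2 - ‖∑ i, inversionField (P.pole i) x‖ ^ 2 := by
  rw [← norm_sum_sq_add_sum_Ioi, potential, add_sub_cancel_left]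
  exact Finset.sum_congr rfl fun i _ => Finset.sum_congr rfl fun j _ =>
    (norm_inversionField_sub_sq (ne_pole hx i) (ne_pole hx j)).symm

theorem potential_nonneg (a : Fin n → E N) (x : E N) : 0 ≤ potential a x :=
  Finset.sum_nonneg fun _ _ => Finset.sum_nonneg fun _ _ => by positivity

theorem contDiffOn_inversionField (P : PoleData N n) (i : Fin n) :
    ContDiffOn ℝ ∞ (inversionField (P.pole i)) P.domain := by
  have h : ContDiff ℝ ∞ fun x : E N => x - P.pole i := contDiff_id.sub contDiff_const
  refine ContDiffOn.smul (ContDiffOn.inv (h.norm_sq ℝ).contDiffOn fun x hx => ?_) h.contDiffOn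
  exact (pow_pos (norm_sub_pole_pos hx i) 2).ne'

theorem contDiffOn_logGrad (P : PoleData N n) : ContDiffOn ℝ ∞ P.logGrad P.domain := by
  refine ContDiffOn.add (ContDiffOn.smul (ContDiffOn.inv P.contDiff_height.contDiffOn
    fun x hx => (mem_domain.1 hx).ne') ?_) (ContDiffOn.const_smul _
      (ContDiffOn.sum fun i _ => P.contDiffOn_inversionField i))
  exact ((contDiff_id.const_smul (2 * P.curv)).add (contDiff_const (c := P.lin))).contDiffOn

theorem contDiffOn_weight (P : PoleData N n) : ContDiffOn ℝ ∞ P.weight P.domain := by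
  refine Real.contDiff_exp.comp_contDiffOn (contDiffOn_const.mul (ContDiffOn.sum fun i _ => ?_))
  have h : ContDiff ℝ ∞ fun x : E N => x - P.pole i := contDiff_id.sub contDiff_const
  exact (h.norm_sq ℝ).contDiffOn.log fun x hx => (pow_pos (norm_sub_pole_pos hx i) 2).ne'

theorem contDiffOn_groundState (P : PoleData N n) : ContDiffOn ℝ ∞ P.groundState P.domain :=
  P.contDiff_height.contDiffOn.mul P.contDiffOn_weight

theorem continuousOn_potential (P : PoleData N n) :
    ContinuousOn (potential P.pole) P.domain := by
  unfold potential
  refine continuousOn_finsetSum _ fun i _ => continuousOn_finsetSum _ fun j _ => ?_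
  refine ContinuousOn.div continuousOn_const (by fun_prop) fun x hx => ?_
  have h1 := norm_sub_pole_pos hx i
  have h2 := norm_sub_pole_pos hx j
  positivity

theorem hasGradientAt_sum {ι : Type*} (s : Finset ι) {f : ι → E N → ℝ} {f' : ι → E N}
    (h : ∀ i, HasGradientAt (f i) (f' i) x) :
    HasGradientAt (fun y => ∑ i ∈ s, f i y) (∑ i ∈ s, f' i) x := by
  rw [hasGradientAt_iff_hasFDerivAt, map_sum]
  exact HasFDerivAt.fun_sum fun i _ => (h i).hasFDerivAt

theorem hasGradientAt_const_mul {f : E N → ℝ} {f' : E N} (t : ℝ) (h : HasGradientAt f f' x) :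
    HasGradientAt (fun y => t * f y) (t • f') x := by
  rw [hasGradientAt_iff_hasFDerivAt, map_smul]
  exact h.hasFDerivAt.const_mul t

theorem hasGradientAt_groundState (hx : x ∈ P.domain) :
    HasGradientAt P.groundState (P.groundState x • P.logGrad x) x := by
  have hlog : ∀ i, HasGradientAt (fun y => Real.log (‖y - P.pole i‖ ^ 2))
      ((2 : ℝ) • inversionField (P.pole i) x) x := by
    intro i
    have h := hasGradientAt_comp (Real.hasDerivAt_log (pow_pos (norm_sub_pole_pos hx i) 2).ne')
      (hasGradientAt_norm_sub_sq (P.pole i) x)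
    convert h using 1
    rw [inversionField, smul_comm]
  have h1 := hasGradientAt_comp (Real.hasDerivAt_exp _)
    (hasGradientAt_const_mul (-(P.expo / 2)) (hasGradientAt_sum Finset.univ hlog))
  have h2 := hasGradientAt_mul (P.hasGradientAt_height x) h1
  have hh : P.height x ≠ 0 := (mem_domain.1 hx).ne'
  suffices hs : P.groundState x • P.logGrad x = _ by
    rw [hs]
    exact h2
  rw [← Finset.smul_sum]
  change (P.height x * P.weight x) • P.logGrad x = P.height x • P.weight x • _ • (2 : ℝ) • _ +
    P.weight x • _
  rw [logGrad, smul_add]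
  simp only [smul_smul]
  rw [add_comm]
  congr 2
  · ring
  · field_simp

theorem isRiccatiField (hn : n ≠ 0) (P : PoleData N n) :
    IsRiccatiField P.domain P.logGrad fun x => P.expo ^ 2 * potential P.pole x where
  contDiffOn := P.contDiffOn_logGrad
  continuousOn := continuousOn_const.mul P.continuousOn_potential
  nonneg x _ := mul_nonneg (sq_nonneg _) (potential_nonneg _ _)
  riccati x hx := by
    have hh : P.height x ≠ 0 := (mem_domain.1 hx).ne'
    have hd := ((HasDivergenceAt.smul (hasGradientAt_comp (hasDerivAt_inv hh)
      (P.hasGradientAt_height x)) (P.hasDivergenceAt_heightGrad x)).add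
      ((HasDivergenceAt.sum Finset.univ fun i =>
        hasDivergenceAt_inversionField (ne_pole hx i)).const_smul (-P.expo))).eq
    have hd' : euclideanTrace (fderiv ℝ P.logGrad x) = _ := hd
    -- The cross term between ∇h/h and the inversion fields: each pole contributes the same constant
    -- curvature, and the total n κ is what balances the Laplacian 2κN of h.
    have hin : inner ℝ (P.heightGrad x) (∑ i, inversionField (P.pole i) x) =
        P.height x * ∑ i, (‖x - P.pole i‖ ^ 2)⁻¹ + n * P.curv := by
      rw [inner_sum]
      have : ∀ i, inner ℝ (P.heightGrad x) (inversionField (P.pole i) x) =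
          P.height x * (‖x - P.pole i‖ ^ 2)⁻¹ + P.curv := by
        intro i
        have h0 := (norm_sub_pole_pos hx i).ne'
        rw [inversionField, inner_smul_right, inner_heightGrad_sub_pole]
        field_simp
      simp only [this, Finset.sum_add_distrib, ← Finset.mul_sum, Finset.sum_const,
        Finset.card_univ, Fintype.card_fin, nsmul_eq_mul]
    have hN : P.expo * n = N := by
      unfold expo
      field_simp
    rw [hd', potential_eq hx, logGrad, norm_add_sq_real, inner_smul_left, inner_smul_right,
      inner_smul_left, real_inner_self_eq_norm_sq, hin, norm_smul, norm_smul, mul_pow, mul_pow,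
      Real.norm_eq_abs, Real.norm_eq_abs, sq_abs, sq_abs, ← Finset.mul_sum]
    -- Writing N as βn cancels 2κN/h against 2βnκ/h; the terms in |∇h|²/h² cancel as well, and β²
    -- times (|∑ v_i|² - n ∑ |v_i|²) = -V remains.
    simp only [norm_inversionField_sq, conj_trivial, ← hN]
    field_simp
    ring

end PoleData

/-! ### The radial kernel and the rate of its integral -/

/-- The kernel `t ^ (-N) (t / (1 + t)²) ^ s`, which is integrable as a function of the distance to
a point of `ℝ^N`, with integral `O(1 / s)`. -/
def radialKernel (N : ℕ) (s t : ℝ) : ℝ := t ^ (-(N : ℝ)) * (t / (1 + t) ^ 2) ^ s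

theorem radialKernel_nonneg (N : ℕ) (s : ℝ) {t : ℝ} (ht : 0 ≤ t) : 0 ≤ radialKernel N s t := by
  unfold radialKernel
  positivity

theorem pow_mul_radialKernel (hN : N ≠ 0) (s : ℝ) {t : ℝ} (ht : 0 < t) :
    t ^ (N - 1) * radialKernel N s t = t⁻¹ * (t / (1 + t) ^ 2) ^ s := by
  have h1 : t ^ (N - 1) * t ^ (-(N : ℝ)) = t⁻¹ := by
    rw [← Real.rpow_natCast, ← Real.rpow_add ht, ← Real.rpow_neg_one,
      Nat.cast_sub (Nat.one_le_iff_ne_zero.2 hN)]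
    congr 1
    push_cast
    ring
  rw [radialKernel, ← mul_assoc, h1]

theorem inv_mul_rpow_le_left {s t : ℝ} (hs : 0 < s) (ht : 0 < t) :
    t⁻¹ * (t / (1 + t) ^ 2) ^ s ≤ t ^ (s - 1) := by
  rw [Real.rpow_sub_one ht.ne', div_eq_inv_mul (t ^ s)]
  refine mul_le_mul_of_nonneg_left (Real.rpow_le_rpow (by positivity) ?_ hs.le) (by positivity)
  exact div_le_self ht.le (one_le_pow₀ (by linarith))

theorem inv_mul_rpow_le_right {s t : ℝ} (hs : 0 < s) (ht : 0 < t) :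
    t⁻¹ * (t / (1 + t) ^ 2) ^ s ≤ t ^ (-s - 1) := by
  rw [Real.rpow_sub_one ht.ne', div_eq_inv_mul (t ^ (-s)), Real.rpow_neg ht.le, ← Real.inv_rpow ht.le]
  refine mul_le_mul_of_nonneg_left (Real.rpow_le_rpow (by positivity) ?_ hs.le) (by positivity)
  rw [div_le_iff₀ (by positivity)]
  have : t⁻¹ * (1 + t) ^ 2 = t + (t⁻¹ + 2) := by field_simp; ring
  rw [this]
  have : 0 < t⁻¹ := by positivity
  linarith

/-- Since t/(1 + t)² is at most both t and 1/t, the integrand is at most t^(s-1) on (0, 1] and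
t^(-s-1) beyond; each piece contributes 1/s. -/
theorem integrableOn_radial {s : ℝ} (hs : 0 < s) :
    IntegrableOn (fun t : ℝ => t⁻¹ * (t / (1 + t) ^ 2) ^ s) (Set.Ioi 0) ∧
      ∫ t in Set.Ioi (0 : ℝ), t⁻¹ * (t / (1 + t) ^ 2) ^ s ≤ 2 / s := by
  have hm : Measurable fun t : ℝ => t⁻¹ * (t / (1 + t) ^ 2) ^ s := by fun_prop
  have e1 : IntegrableOn (fun t : ℝ => t ^ (s - 1)) (Set.Ioc 0 1) :=
    (intervalIntegrable_iff_integrableOn_Ioc_of_le zero_le_one).1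
      (intervalIntegral.intervalIntegrable_rpow' (by linarith))
  have e2 : IntegrableOn (fun t : ℝ => t ^ (-s - 1)) (Set.Ioi 1) :=
    integrableOn_Ioi_rpow_of_lt (by linarith) one_pos
  have b1 : ∀ t ∈ Set.Ioc (0 : ℝ) 1, t⁻¹ * (t / (1 + t) ^ 2) ^ s ≤ t ^ (s - 1) :=
    fun t ht => inv_mul_rpow_le_left hs ht.1
  have b2 : ∀ t ∈ Set.Ioi (1 : ℝ), t⁻¹ * (t / (1 + t) ^ 2) ^ s ≤ t ^ (-s - 1) :=
    fun t ht => inv_mul_rpow_le_right hs (one_pos.trans ht)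
  have i1 : IntegrableOn (fun t : ℝ => t⁻¹ * (t / (1 + t) ^ 2) ^ s) (Set.Ioc 0 1) := by
    refine e1.mono' hm.aestronglyMeasurable ?_
    refine (ae_restrict_mem measurableSet_Ioc).mono fun t ht => ?_
    have := ht.1
    rw [Real.norm_of_nonneg (by positivity)]
    exact b1 t ht
  have i2 : IntegrableOn (fun t : ℝ => t⁻¹ * (t / (1 + t) ^ 2) ^ s) (Set.Ioi 1) := by
    refine e2.mono' hm.aestronglyMeasurable ?_
    refine (ae_restrict_mem measurableSet_Ioi).mono fun t ht => ?_
    have : 0 < t := one_pos.trans ht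
    rw [Real.norm_of_nonneg (by positivity)]
    exact b2 t ht
  have hU : Set.Ioc (0 : ℝ) 1 ∪ Set.Ioi 1 = Set.Ioi 0 := Set.Ioc_union_Ioi_eq_Ioi zero_le_one
  refine ⟨hU ▸ i1.union i2, ?_⟩
  rw [← hU, setIntegral_union Set.Ioc_disjoint_Ioi_same measurableSet_Ioi i1 i2]
  have c1 := setIntegral_mono_on i1 e1 measurableSet_Ioc b1
  have c2 := setIntegral_mono_on i2 e2 measurableSet_Ioi b2
  rw [← intervalIntegral.integral_of_le zero_le_one (f := fun t : ℝ => t ^ (s - 1)),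
    integral_rpow (Or.inl (by linarith))] at c1
  rw [integral_Ioi_rpow_of_lt (by linarith) one_pos] at c2
  simp only [sub_add_cancel, Real.one_rpow, Real.zero_rpow hs.ne', sub_zero] at c1 c2
  have : (2 : ℝ) / s = 1 / s + -1 / -s := by field_simp; norm_num
  linarith

/-- Polar coordinates reduce this to the one-dimensional integral. The explicit rate in s matters:
with s = 2ε it is beaten by the ε² of the cut-off gradient, and for fixed s > 0 it gives finite
energy. -/
theorem exists_lintegral_radialKernel_le (hN : N ≠ 0) :
    ∃ C : ℝ, 0 < C ∧ ∀ s, 0 < s → ∀ p : E N,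
      ∫⁻ x, ENNReal.ofReal (radialKernel N s ‖x - p‖) ≤ ENNReal.ofReal (C / s) := by
  have : Nonempty (Fin N) := ⟨⟨0, Nat.pos_of_ne_zero hN⟩⟩
  refine ⟨(N * volume.real (Metric.ball (0 : E N) 1) + 1) * 2, by positivity, fun s hs p => ?_⟩
  have hr := integrableOn_radial hs
  have hcongr : Set.EqOn (fun t : ℝ => t ^ (Module.finrank ℝ (E N) - 1) • radialKernel N s t)
      (fun t => t⁻¹ * (t / (1 + t) ^ 2) ^ s) (Set.Ioi 0) := by
    intro t ht
    simp only [finrank_euclideanSpace, Fintype.card_fin, smul_eq_mul]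
    exact pow_mul_radialKernel hN s ht
  have hi : Integrable (fun x : E N => radialKernel N s ‖x‖) := by
    rw [integrable_fun_norm_addHaar volume (f := radialKernel N s)]
    exact hr.1.congr_fun hcongr.symm measurableSet_Ioi
  have hint : ∫ x : E N, radialKernel N s ‖x‖ ≤
      (N * volume.real (Metric.ball (0 : E N) 1) + 1) * 2 / s := by
    rw [integral_fun_norm_addHaar volume (radialKernel N s),
      setIntegral_congr_fun measurableSet_Ioi hcongr]
    simp only [finrank_euclideanSpace, Fintype.card_fin, nsmul_eq_mul, smul_eq_mul]
    rw [← mul_assoc, mul_div_assoc]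
    have h0 : 0 ≤ (N : ℝ) * volume.real (Metric.ball (0 : E N) 1) := by positivity
    have h2 : 0 ≤ 2 / s := by positivity
    refine (mul_le_mul_of_nonneg_left hr.2 h0).trans ?_
    exact mul_le_mul_of_nonneg_right (by linarith) h2
  rw [lintegral_sub_right_eq_self (fun x : E N => ENNReal.ofReal (radialKernel N s ‖x‖)) p,
    ← ofReal_integral_eq_lintegral_ofReal hi
      (ae_of_all _ fun x => radialKernel_nonneg N s (norm_nonneg x))]
  exact ENNReal.ofReal_le_ofReal hint

/-! ### Pointwise estimates near the poles and at infinity -/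

namespace PoleData

variable (P : PoleData N n)

/-- `R` bounds the data and the inverse distances of the poles. -/
structure IsBound (R : ℝ) : Prop where
  one_le : 1 ≤ R
  norm_pole : ∀ i, ‖P.pole i‖ ≤ R
  curv : |P.curv| ≤ R
  lin : ‖P.lin‖ ≤ R
  cst : |P.cst| ≤ R
  dist : ∀ i j, i ≠ j → 1 ≤ R * ‖P.pole i - P.pole j‖

theorem exists_isBound : ∃ R : ℝ, P.IsBound R := by
  have h1 : ∀ i, ‖P.pole i‖ ≤ ∑ i, ‖P.pole i‖ := fun i =>
    Finset.single_le_sum (f := fun i => ‖P.pole i‖) (fun i _ => norm_nonneg _) (Finset.mem_univ i)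
  have h2 : ∀ i j, ‖P.pole i - P.pole j‖⁻¹ ≤ ∑ i, ∑ j, ‖P.pole i - P.pole j‖⁻¹ := fun i j =>
    (Finset.single_le_sum (f := fun j => ‖P.pole i - P.pole j‖⁻¹)
      (fun j _ => inv_nonneg.2 (norm_nonneg _)) (Finset.mem_univ j)).trans
    (Finset.single_le_sum (f := fun i => ∑ j, ‖P.pole i - P.pole j‖⁻¹)
      (fun i _ => Finset.sum_nonneg fun j _ => inv_nonneg.2 (norm_nonneg _)) (Finset.mem_univ i))
  have h3 : 0 ≤ ∑ i, ‖P.pole i‖ := Finset.sum_nonneg fun i _ => norm_nonneg _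
  have h4 : 0 ≤ ∑ i, ∑ j, ‖P.pole i - P.pole j‖⁻¹ :=
    Finset.sum_nonneg fun i _ => Finset.sum_nonneg fun j _ => inv_nonneg.2 (norm_nonneg _)
  generalize ∑ i, ‖P.pole i‖ = S at h1 h3
  generalize ∑ i, ∑ j, ‖P.pole i - P.pole j‖⁻¹ = T at h2 h4
  have h5 := abs_nonneg P.curv
  have h6 := abs_nonneg P.cst
  have h7 := norm_nonneg P.lin
  refine ⟨1 + S + |P.curv| + ‖P.lin‖ + |P.cst| + T, by linarith, fun i => ?_, by linarith,
    by linarith, by linarith, fun i j hij => ?_⟩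
  · linarith [h1 i]
  · have hp : 0 < ‖P.pole i - P.pole j‖ :=
      norm_pos_iff.2 (sub_ne_zero.2 fun h => hij (P.injective h))
    rw [← div_le_iff₀ hp, one_div]
    linarith [h2 i j]

/-- The function `h / (1 + |x|²)²`, whose logarithm is used to build cut-off functions. -/
def decay (x : E N) : ℝ := P.height x / (1 + ‖x‖ ^ 2) ^ 2

/-- The gradient of `log (h / (1 + |x|²)²)`. -/
def decayGrad (x : E N) : E N :=
  (P.height x)⁻¹ • P.heightGrad x - (4 / (1 + ‖x‖ ^ 2)) • x

variable {P}

theorem log_weight_sq (P : PoleData N n) (x : E N) :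
    P.weight x ^ 2 = Real.exp (-(2 * P.expo) * ∑ i, Real.log ‖x - P.pole i‖) := by
  rw [weight, ← Real.exp_nat_mul]
  congr 1
  simp only [Real.log_pow, ← Finset.mul_sum]
  push_cast
  ring

theorem exists_nearest_pole (hn : n ≠ 0) (P : PoleData N n) (x : E N) :
    ∃ k, ∀ j, ‖x - P.pole k‖ ≤ ‖x - P.pole j‖ := by
  have : Nonempty (Fin n) := ⟨⟨0, Nat.pos_of_ne_zero hn⟩⟩
  exact Finite.exists_min fun j => ‖x - P.pole j‖

theorem one_add_norm_sq_le (x : E N) : (1 + ‖x‖) ^ 2 ≤ 2 * (1 + ‖x‖ ^ 2) := by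
  nlinarith [sq_nonneg (1 - ‖x‖)]

namespace IsBound

variable {R : ℝ}

theorem pos (h : P.IsBound R) : 0 < R := zero_lt_one.trans_le h.one_le

theorem norm_sub_pole_le (h : P.IsBound R) (x : E N) (i : Fin n) :
    ‖x - P.pole i‖ ≤ R * (1 + ‖x‖) := by
  have h1 := norm_sub_le x (P.pole i)
  have h2 := h.norm_pole i
  have h3 := mul_le_mul_of_nonneg_right h.one_le (norm_nonneg x)
  linarith

theorem one_add_norm_sub_pole_le (h : P.IsBound R) (x : E N) (i : Fin n) :
    1 + ‖x - P.pole i‖ ≤ 2 * R * (1 + ‖x‖) := by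
  have h1 := h.norm_sub_pole_le x i
  have h2 := mul_le_mul_of_nonneg_right h.one_le (norm_nonneg x)
  linarith [norm_nonneg x, h.one_le]

theorem norm_heightGrad_le (h : P.IsBound R) (x : E N) :
    ‖P.heightGrad x‖ ≤ 2 * R * (1 + ‖x‖) := by
  have h1 := norm_add_le ((2 * P.curv) • x) P.lin
  rw [norm_smul, Real.norm_eq_abs, abs_mul, abs_of_pos (two_pos : (0 : ℝ) < 2)] at h1
  have h2 := mul_le_mul_of_nonneg_right h.curv (norm_nonneg x)
  have h3 := h.lin
  rw [heightGrad]
  linarith [h.pos]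

theorem height_le (h : P.IsBound R) (x : E N) : P.height x ≤ R * (1 + ‖x‖) ^ 2 := by
  have h1 := (abs_le.1 h.curv).2
  have h2 := (abs_le.1 h.cst).2
  have h3 := (real_inner_le_norm P.lin x).trans
    (mul_le_mul_of_nonneg_right h.lin (norm_nonneg x))
  have h4 := mul_le_mul_of_nonneg_right h1 (sq_nonneg ‖x‖)
  have h5 := mul_nonneg h.pos.le (norm_nonneg x)
  rw [height]
  linarith

/-- The exact Taylor identity at a pole bounds h by |∇h| |x - a_i| plus a quadratic term, so h
vanishes at least linearly at every pole. -/
theorem height_le_mul (h : P.IsBound R) (x : E N) (i : Fin n) :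
    P.height x ≤ 3 * R ^ 2 * (1 + ‖x‖) * ‖x - P.pole i‖ := by
  have h0 := P.inner_heightGrad_sub_pole x i
  have h1 := (real_inner_le_norm (P.heightGrad x) (x - P.pole i)).trans
    (mul_le_mul_of_nonneg_right (h.norm_heightGrad_le x) (norm_nonneg _))
  have h2 : -P.curv * ‖x - P.pole i‖ ^ 2 ≤ R * ‖x - P.pole i‖ ^ 2 :=
    mul_le_mul_of_nonneg_right (neg_le.1 (abs_le.1 h.curv).1) (sq_nonneg _)
  have h3 := mul_le_mul_of_nonneg_right (h.norm_sub_pole_le x i) (norm_nonneg (x - P.pole i))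
  have h4 := mul_le_mul_of_nonneg_left h3 h.pos.le
  have h5 : R * ((1 + ‖x‖) * ‖x - P.pole i‖) ≤ R ^ 2 * ((1 + ‖x‖) * ‖x - P.pole i‖) :=
    mul_le_mul_of_nonneg_right (le_self_pow₀ h.one_le two_ne_zero) (by positivity)
  linarith

theorem decay_le (x : E N) {s : ℝ} (hs : P.height x ≤ s * (1 + ‖x‖) ^ 2) (hs0 : 0 ≤ s) :
    P.decay x ≤ 4 * s / (1 + ‖x‖) ^ 2 := by
  have hm := one_add_norm_sq_le x
  have hm1 : 0 < (1 + ‖x‖) ^ 2 := by positivity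
  rw [decay, div_le_div_iff₀ (by positivity) hm1]
  have h1 := mul_le_mul_of_nonneg_right hs hm1.le
  have h2 : (1 + ‖x‖) ^ 2 * (1 + ‖x‖) ^ 2 ≤ (2 * (1 + ‖x‖ ^ 2)) * (2 * (1 + ‖x‖ ^ 2)) :=
    mul_le_mul hm hm hm1.le (by positivity)
  have h3 := mul_le_mul_of_nonneg_left h2 hs0
  linarith

/-- All poles but the nearest one are far away, relative to `1 + |x|`. -/
theorem one_add_norm_le (h : P.IsBound R) {x : E N} {k : Fin n}
    (hk : ∀ j, ‖x - P.pole k‖ ≤ ‖x - P.pole j‖) {j : Fin n} (hj : j ≠ k) :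
    1 + ‖x‖ ≤ 5 * R ^ 2 * ‖x - P.pole j‖ := by
  have hR := h.pos
  have h2 : ‖P.pole j - P.pole k‖ ≤ ‖x - P.pole k‖ + ‖x - P.pole j‖ := by
    have := norm_sub_le (x - P.pole k) (x - P.pole j)
    rwa [sub_sub_sub_cancel_left] at this
  have h3 : ‖P.pole j - P.pole k‖ ≤ 2 * ‖x - P.pole j‖ := by linarith [hk j]
  -- Distinct poles are at least 1/R apart and a_k is nearest, so |x - a_j| ≥ 1/(2R). This absorbs
  -- the additive constant 1 + R ≤ 2R.
  have h4 : 1 ≤ 2 * R * ‖x - P.pole j‖ := by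
    have := (h.dist j k hj).trans (mul_le_mul_of_nonneg_left h3 hR.le)
    linarith
  have h5 : ‖x‖ ≤ ‖x - P.pole j‖ + R := by
    have := norm_add_le (x - P.pole j) (P.pole j)
    rw [sub_add_cancel] at this
    linarith [h.norm_pole j]
  have h7 : 2 * R * 1 ≤ 2 * R * (2 * R * ‖x - P.pole j‖) :=
    mul_le_mul_of_nonneg_left h4 (by positivity)
  have h8 : 1 * ‖x - P.pole j‖ ≤ R ^ 2 * ‖x - P.pole j‖ :=
    mul_le_mul_of_nonneg_right (one_le_pow₀ h.one_le) (norm_nonneg _)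
  linarith [h.one_le]

theorem decay_le_nearest (h : P.IsBound R) (x : E N) (k : Fin n) :
    P.decay x ≤ 48 * R ^ 4 * (‖x - P.pole k‖ / (1 + ‖x - P.pole k‖) ^ 2) := by
  have h1 : P.height x ≤ 3 * R ^ 2 * ‖x - P.pole k‖ * (1 + ‖x‖) ^ 2 := by
    have h3 : 3 * R ^ 2 * ‖x - P.pole k‖ * (1 + ‖x‖) ≤
        3 * R ^ 2 * ‖x - P.pole k‖ * (1 + ‖x‖) ^ 2 :=
      mul_le_mul_of_nonneg_left (le_self_pow₀ (by linarith [norm_nonneg x]) two_ne_zero)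
        (by positivity)
    linarith [h.height_le_mul x k]
  refine (decay_le x h1 (by positivity)).trans ?_
  rw [mul_div_assoc', div_le_div_iff₀ (by positivity) (by positivity)]
  have h5 : (1 + ‖x - P.pole k‖) ^ 2 ≤ (2 * R * (1 + ‖x‖)) ^ 2 :=
    pow_le_pow_left₀ (by positivity) (h.one_add_norm_sub_pole_le x k) 2
  have h6 := mul_le_mul_of_nonneg_left h5
    (by positivity : 0 ≤ 4 * (3 * R ^ 2 * ‖x - P.pole k‖))
  exact h6.trans (le_of_eq (by ring))

/-- In every pair of poles one is not the nearest, so its distance to x is comparable to 1 + |x|.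
The linear vanishing of h at the other pole then bounds h by the product of the two distances, which
compensates the denominator of V. -/
theorem potential_mul_height_sq_le (h : P.IsBound R) {x : E N} (hx : x ∈ P.domain) {k : Fin n}
    (hk : ∀ j, ‖x - P.pole k‖ ≤ ‖x - P.pole j‖) :
    potential P.pole x * P.height x ^ 2 ≤ n * (n * ((2 * R) ^ 2 * (15 * R ^ 4) ^ 2)) := by
  have hh : 0 < P.height x := hx
  have pair : ∀ i j, i ≠ k → P.height x ≤ 15 * R ^ 4 * (‖x - P.pole i‖ * ‖x - P.pole j‖) := by
    intro i j hi
    have h1 := h.height_le_mul x j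
    have h2 := mul_le_mul_of_nonneg_right (h.one_add_norm_le hk hi)
      (by positivity : 0 ≤ 3 * R ^ 2 * ‖x - P.pole j‖)
    linarith
  have hterm : ∀ i j, i ≠ j → ‖P.pole i - P.pole j‖ ^ 2 /
      (‖x - P.pole i‖ ^ 2 * ‖x - P.pole j‖ ^ 2) * P.height x ^ 2 ≤
      (2 * R) ^ 2 * (15 * R ^ 4) ^ 2 := by
    intro i j hij
    have h1 := norm_sub_pole_pos hx i
    have h2 := norm_sub_pole_pos hx j
    have h3 : P.height x ≤ 15 * R ^ 4 * (‖x - P.pole i‖ * ‖x - P.pole j‖) := by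
      by_cases hik : i = k
      · rw [mul_comm ‖x - P.pole i‖]
        exact pair j i fun h => hij (hik.trans h.symm)
      · exact pair i j hik
    have h4 : ‖P.pole i - P.pole j‖ ≤ 2 * R :=
      (norm_sub_le _ _).trans (by linarith [h.norm_pole i, h.norm_pole j])
    rw [← mul_pow, div_mul_eq_mul_div, div_le_iff₀ (by positivity), mul_assoc,
      ← mul_pow (15 * R ^ 4)]
    exact mul_le_mul (pow_le_pow_left₀ (norm_nonneg _) h4 2) (pow_le_pow_left₀ hh.le h3 2)
      (by positivity) (by positivity)
  rw [potential, Finset.sum_mul]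
  calc _ ≤ ∑ i : Fin n, ∑ j ∈ Finset.Ioi i, (2 * R) ^ 2 * (15 * R ^ 4) ^ 2 := by
        refine Finset.sum_le_sum fun i _ => ?_
        rw [Finset.sum_mul]
        exact Finset.sum_le_sum fun j hj => hterm i j (Finset.mem_Ioi.1 hj).ne
    _ ≤ ∑ i : Fin n, ∑ j : Fin n, (2 * R) ^ 2 * (15 * R ^ 4) ^ 2 :=
        Finset.sum_le_sum fun i _ => Finset.sum_le_sum_of_subset_of_nonneg
          (Finset.subset_univ _) fun _ _ _ => by positivity
    _ = _ := by simp

/-- The factor h of the ground state cancels the singularity 1/h of the logarithmic gradient, and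
what is left grows at most linearly. -/
theorem groundState_mul_decayGrad_le (h : P.IsBound R) {x : E N} (hx : x ∈ P.domain) :
    P.groundState x ^ 2 * ‖P.decayGrad x‖ ^ 2 ≤
      (10 * R) ^ 2 * (P.weight x ^ 2 * (1 + ‖x‖) ^ 2) := by
  have hh : 0 < P.height x := hx
  have hR := h.pos
  have h1 : P.groundState x ^ 2 * ‖P.decayGrad x‖ ^ 2 =
      P.weight x ^ 2 * ‖P.heightGrad x - (4 * P.height x / (1 + ‖x‖ ^ 2)) • x‖ ^ 2 := by
    have : P.heightGrad x - (4 * P.height x / (1 + ‖x‖ ^ 2)) • x =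
        P.height x • P.decayGrad x := by
      rw [decayGrad, smul_sub, smul_smul, smul_smul, mul_inv_cancel₀ hh.ne', one_smul]
      congr 2
      ring
    rw [this, norm_smul, groundState, Real.norm_of_nonneg hh.le]
    ring
  have h2 : ‖P.heightGrad x - (4 * P.height x / (1 + ‖x‖ ^ 2)) • x‖ ≤ 10 * R * (1 + ‖x‖) := by
    refine (norm_sub_le _ _).trans ?_
    rw [norm_smul, Real.norm_of_nonneg (by positivity)]
    have h3 : 4 * P.height x / (1 + ‖x‖ ^ 2) ≤ 8 * R := by
      rw [div_le_iff₀ (by positivity)]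
      have := mul_le_mul_of_nonneg_left (one_add_norm_sq_le x) hR.le
      linarith [h.height_le x]
    have h4 := mul_le_mul_of_nonneg_right h3 (norm_nonneg x)
    have h5 := h.norm_heightGrad_le x
    linarith
  rw [h1]
  calc _ ≤ P.weight x ^ 2 * (10 * R * (1 + ‖x‖)) ^ 2 :=
        mul_le_mul_of_nonneg_left (pow_le_pow_left₀ (norm_nonneg _) h2 2) (by positivity)
    _ = _ := by ring

end IsBound

theorem expo_mul (hn : n ≠ 0) (P : PoleData N n) : P.expo * n = N := by
  unfold expo
  field_simp

theorem expo_nonneg (P : PoleData N n) : 0 ≤ P.expo := by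
  unfold expo
  positivity

theorem two_mul_expo_le (hn : 2 ≤ n) (P : PoleData N n) : 2 * P.expo ≤ N := by
  have hn2 : (2 : ℝ) ≤ n := by exact_mod_cast hn
  have := mul_le_mul_of_nonneg_left hn2 P.expo_nonneg
  rw [P.expo_mul (by omega)] at this
  linarith

/-- Bounds for the weight in terms of the distance to the nearest pole. -/
theorem IsBound.weight_sq_le {R : ℝ} (h : P.IsBound R) (hN : 2 ≤ N) (hn : 2 ≤ n) :
    ∃ A : ℝ, 1 ≤ A ∧ ∀ x ∈ P.domain, ∀ k, (∀ j, ‖x - P.pole k‖ ≤ ‖x - P.pole j‖) →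
      P.weight x ^ 2 * (1 + ‖x‖) ^ 2 ≤ A * ‖x - P.pole k‖ ^ (-(N : ℝ)) ∧
      P.weight x ^ 2 ≤ A * radialKernel N (N - 2 * P.expo) ‖x - P.pole k‖ := by
  have hβ := P.expo_mul (by omega)
  have hN2 : (2 : ℝ) ≤ N := by exact_mod_cast hN
  have hβ0 := P.expo_nonneg
  have hβ2 := P.two_mul_expo_le hn
  have hR0 := h.pos
  set Λ : ℝ := Real.log (5 * R ^ 2) with hΛ
  have hΛ0 : 0 ≤ Λ := Real.log_nonneg (by linarith [one_le_pow₀ h.one_le (n := 2)])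
  refine ⟨Real.exp (2 * N * Λ + 2 * N * Λ), Real.one_le_exp (by positivity), fun x hx k hk => ?_⟩
  have htk := norm_sub_pole_pos hx k
  set m : ℝ := 1 + ‖x‖ with hm
  have hm1 : 1 ≤ m := by linarith [norm_nonneg x]
  have hm0 : 0 < m := by linarith
  set L : ℝ := Real.log m with hL
  have hL0 : 0 ≤ L := Real.log_nonneg hm1
  set τ : ℝ := Real.log ‖x - P.pole k‖ with hτ
  set σ : ℝ := Real.log (1 + ‖x - P.pole k‖) with hσ
  have hσL : σ ≤ L + Λ := by
    rw [hσ, hL, hΛ, ← Real.log_mul (by positivity) (by positivity)]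
    refine Real.log_le_log (by positivity) ((h.one_add_norm_sub_pole_le x k).trans ?_)
    have h1 := mul_le_mul_of_nonneg_right (le_self_pow₀ h.one_le two_ne_zero) hm0.le
    have h2 : 0 ≤ R ^ 2 * m := by positivity
    linarith
  have hτσ : τ ≤ σ := Real.log_le_log htk (by linarith)
  -- The nearest pole contributes τ and each of the n - 1 others at least L - Λ. After
  -- multiplication by -2β, the relation βn = N turns 2β(n - 1) into 2N - 2β.
  have hsum : τ + (n - 1) * (L - Λ) ≤ ∑ i, Real.log ‖x - P.pole i‖ := by
    rw [← Finset.add_sum_erase _ _ (Finset.mem_univ k)]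
    refine add_le_add le_rfl ?_
    have : ∑ i ∈ Finset.univ.erase k, (L - Λ) ≤
        ∑ i ∈ Finset.univ.erase k, Real.log ‖x - P.pole i‖ := by
      refine Finset.sum_le_sum fun j hj => ?_
      have h1 := Real.log_le_log hm0 (h.one_add_norm_le hk (Finset.ne_of_mem_erase hj))
      rw [Real.log_mul (by positivity) (norm_sub_pole_pos hx j).ne'] at h1
      linarith
    refine le_trans (le_of_eq ?_) this
    rw [Finset.sum_const, Finset.card_erase_of_mem (Finset.mem_univ k), Finset.card_univ,
      Fintype.card_fin, nsmul_eq_mul, Nat.cast_sub (by omega), Nat.cast_one]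
  have hw : P.weight x ^ 2 ≤
      Real.exp (-(2 * P.expo) * τ - (2 * N - 2 * P.expo) * (L - Λ)) := by
    rw [log_weight_sq, Real.exp_le_exp]
    have := mul_le_mul_of_nonneg_left hsum (by positivity : 0 ≤ 2 * P.expo)
    rw [← hβ]
    linarith
  have hm2 : m ^ 2 = Real.exp (2 * L) := by
    rw [two_mul, Real.exp_add, hL, Real.exp_log hm0, sq]
  have hβΛ : 0 ≤ P.expo * Λ := by positivity
  have hNΛ : 0 ≤ N * Λ := by positivity
  have hβL : 0 ≤ P.expo * L := by positivity
  constructor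
  -- Since 2β ≤ N, part of τ may be traded for L + Λ. The remaining power of 1 + |x| has exponent 2
  -- - N ≤ 0.
  · have h1 : (N - 2 * P.expo) * τ ≤ (N - 2 * P.expo) * (L + Λ) :=
      mul_le_mul_of_nonneg_left (hτσ.trans hσL) (by linarith)
    have h2 : 2 * L ≤ N * L := mul_le_mul_of_nonneg_right hN2 hL0
    rw [hm2, Real.rpow_def_of_pos htk, ← Real.exp_add]
    refine (mul_le_mul_of_nonneg_right hw (Real.exp_pos _).le).trans ?_
    rw [← Real.exp_add, Real.exp_le_exp]
    linarith
  · have h1 : (N - 2 * P.expo) * σ ≤ (N - 2 * P.expo) * (L + Λ) :=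
      mul_le_mul_of_nonneg_left hσL (by linarith)
    have h3 : Real.log (‖x - P.pole k‖ / (1 + ‖x - P.pole k‖) ^ 2) = τ - 2 * σ := by
      rw [Real.log_div htk.ne' (by positivity), Real.log_pow]
      push_cast
      ring
    rw [radialKernel, Real.rpow_def_of_pos htk, Real.rpow_def_of_pos (by positivity), h3,
      ← Real.exp_add, ← Real.exp_add]
    refine hw.trans ?_
    rw [Real.exp_le_exp]
    linarith

/-- The pointwise estimates, in terms of the distance to the nearest pole. -/
theorem exists_estimates (hN : 2 ≤ N) (hn : 2 ≤ n) (P : PoleData N n) :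
    ∃ C : ℝ, 1 ≤ C ∧ (∀ x ∈ P.domain, ∃ k,
      P.groundState x ^ 2 * ‖P.decayGrad x‖ ^ 2 ≤ C * ‖x - P.pole k‖ ^ (-(N : ℝ)) ∧
      P.decay x ≤ C * (‖x - P.pole k‖ / (1 + ‖x - P.pole k‖) ^ 2) ∧
      potential P.pole x * P.groundState x ^ 2 ≤
        C * radialKernel N (N - 2 * P.expo) ‖x - P.pole k‖) ∧
      ∀ x ∈ P.domain, P.decay x ≤ C / (1 + ‖x‖) ^ 2 := by
  obtain ⟨R, h⟩ := P.exists_isBound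
  obtain ⟨A, hA, hw⟩ := h.weight_sq_le hN hn
  have hR := h.pos
  obtain ⟨B, hB0, hB⟩ : ∃ B : ℝ, 0 ≤ B ∧ n * (n * ((2 * R) ^ 2 * (15 * R ^ 4) ^ 2)) = B :=
    ⟨_, by positivity, rfl⟩
  have p1 : 0 ≤ (10 * R) ^ 2 * A := by positivity
  have p2 : 0 ≤ 48 * R ^ 4 := by positivity
  have p3 : 0 ≤ B * A := by positivity
  have hC : ∃ C, (10 * R) ^ 2 * A ≤ C ∧ 48 * R ^ 4 ≤ C ∧ B * A ≤ C ∧ 4 * R ≤ C ∧ 1 ≤ C :=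
    ⟨(10 * R) ^ 2 * A + 48 * R ^ 4 + B * A + 4 * R + 1, by linarith, by linarith, by linarith,
      by linarith, by linarith⟩
  obtain ⟨C, c1, c2, c3, c4, c5⟩ := hC
  refine ⟨C, c5, fun x hx => ?_, fun x _ => ?_⟩
  · obtain ⟨k, hk⟩ := exists_nearest_pole (by omega) P x
    obtain ⟨hw1, hw2⟩ := hw x hx k hk
    have hK := radialKernel_nonneg N (N - 2 * P.expo) (norm_nonneg (x - P.pole k))
    refine ⟨k, ?_, ?_, ?_⟩
    · refine (h.groundState_mul_decayGrad_le hx).trans ?_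
      refine (mul_le_mul_of_nonneg_left hw1 (by positivity)).trans ?_
      rw [← mul_assoc]
      exact mul_le_mul_of_nonneg_right c1 (by positivity)
    · exact (h.decay_le_nearest x k).trans (mul_le_mul_of_nonneg_right c2 (by positivity))
    · have h1 := h.potential_mul_height_sq_le hx hk
      rw [hB] at h1
      calc potential P.pole x * P.groundState x ^ 2
          = potential P.pole x * P.height x ^ 2 * P.weight x ^ 2 := by rw [groundState]; ring
        _ ≤ B * (A * radialKernel N (N - 2 * P.expo) ‖x - P.pole k‖) :=
          mul_le_mul h1 hw2 (by positivity) hB0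
        _ ≤ _ := by
          rw [← mul_assoc]
          exact mul_le_mul_of_nonneg_right c3 hK
  · refine (IsBound.decay_le x (h.height_le x) hR.le).trans ?_
    exact div_le_div_of_nonneg_right c4 (by positivity)

end PoleData

/-! ### Logarithmic cut-offs and truncations of the ground state -/

/-- The derivative is continuous on [0, 1] and vanishes off that interval. Its vanishing for
negative arguments confines the cut-off gradient to ε log d ≥ -2. -/
theorem exists_abs_deriv_smoothTransition_le :
    ∃ M : ℝ, 0 ≤ M ∧ (∀ s, |deriv Real.smoothTransition s| ≤ M) ∧
      ∀ s < 0, deriv Real.smoothTransition s = 0 := by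
  have hc : Continuous (deriv Real.smoothTransition) :=
    (Real.smoothTransition.contDiff (n := 1)).continuous_deriv (by simp)
  have hneg : ∀ s < 0, deriv Real.smoothTransition s = 0 := by
    intro s hs
    have : Real.smoothTransition =ᶠ[𝓝 s] fun _ => 0 := by
      filter_upwards [Iio_mem_nhds hs] with t ht using Real.smoothTransition.zero_of_nonpos ht.le
    rw [this.deriv_eq, deriv_const]
  have hpos : ∀ s > 1, deriv Real.smoothTransition s = 0 := by
    intro s hs
    have : Real.smoothTransition =ᶠ[𝓝 s] fun _ => 1 := by
      filter_upwards [Ioi_mem_nhds hs] with t ht using Real.smoothTransition.one_of_one_le ht.le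
    rw [this.deriv_eq, deriv_const]
  obtain ⟨M, hM⟩ := isCompact_Icc.exists_bound_of_continuousOn (s := Set.Icc (0 : ℝ) 1)
    hc.continuousOn
  have hM0 : 0 ≤ M := (norm_nonneg _).trans (hM 0 (by simp))
  refine ⟨M, hM0, fun s => ?_, hneg⟩
  by_cases h : s ∈ Set.Icc (0 : ℝ) 1
  · exact hM s h
  · rcases lt_or_ge s 0 with h0 | h0
    · simpa [hneg s h0] using hM0
    · have : 1 < s := by
        by_contra h1
        exact h ⟨h0, not_lt.1 h1⟩
      simpa [hpos s this] using hM0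

namespace PoleData

variable {P : PoleData N n} {x : E N}

/-- The logarithmic cut-off function. -/
def cutoff (P : PoleData N n) (ε : ℝ) (x : E N) : ℝ :=
  Real.smoothTransition (ε * Real.log (P.decay x) + 2)

theorem decay_pos (hx : x ∈ P.domain) : 0 < P.decay x :=
  div_pos hx (by positivity)

theorem mem_domain_of_decay_pos (hx : 0 < P.decay x) : x ∈ P.domain := by
  by_contra h
  exact absurd hx (not_lt.2 (div_nonpos_of_nonpos_of_nonneg (not_lt.1 h) (by positivity)))

theorem contDiff_decay (P : PoleData N n) : ContDiff ℝ ∞ P.decay := by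
  unfold decay
  exact P.contDiff_height.div ((contDiff_const.add (contDiff_norm_sq ℝ)).pow 2)
    fun x => by positivity

theorem contDiffOn_cutoff (P : PoleData N n) (ε : ℝ) : ContDiffOn ℝ ∞ (P.cutoff ε) P.domain := by
  refine Real.smoothTransition.contDiff.comp_contDiffOn ?_
  exact (contDiffOn_const.mul (P.contDiff_decay.contDiffOn.log fun x hx => (decay_pos hx).ne')).add
    contDiffOn_const

theorem hasGradientAt_log_decay (hx : x ∈ P.domain) :
    HasGradientAt (fun y => Real.log (P.decay y)) (P.decayGrad x) x := by
  have hh : P.height x ≠ 0 := (mem_domain.1 hx).ne'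
  have h1 := hasGradientAt_comp (Real.hasDerivAt_log hh) (P.hasGradientAt_height x)
  have h2 : HasGradientAt (fun y : E N => ‖y‖ ^ 2) ((2 : ℝ) • x) x := by
    simpa using hasGradientAt_norm_sub_sq (0 : E N) x
  have h3 : HasDerivAt (fun t : ℝ => -2 * Real.log (1 + t)) (-2 * (1 / (1 + ‖x‖ ^ 2)))
      (‖x‖ ^ 2) := by
    have := ((hasDerivAt_id (‖x‖ ^ 2)).const_add 1).log (by simp only [id]; positivity)
    exact this.const_mul (-2)
  have h4 := hasGradientAt_add h1 (hasGradientAt_comp h3 h2)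
  have hd : P.decayGrad x =
      (P.height x)⁻¹ • P.heightGrad x + (-2 * (1 / (1 + ‖x‖ ^ 2))) • (2 : ℝ) • x := by
    rw [decayGrad, smul_smul, sub_eq_add_neg, ← neg_smul]
    congr 2
    ring
  rw [hd]
  rw [hasGradientAt_iff_hasFDerivAt] at *
  refine h4.congr_of_eventuallyEq ?_
  filter_upwards [P.domain.isOpen.mem_nhds hx] with y hy
  rw [decay, Real.log_div (mem_domain.1 hy).ne' (by positivity), Real.log_pow]
  push_cast
  ring

theorem hasGradientAt_cutoff (hx : x ∈ P.domain) (ε : ℝ) :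
    HasGradientAt (P.cutoff ε) ((deriv Real.smoothTransition (ε * Real.log (P.decay x) + 2) * ε) •
      P.decayGrad x) x := by
  have h1 : HasDerivAt (fun s : ℝ => Real.smoothTransition (ε * s + 2))
      (deriv Real.smoothTransition (ε * Real.log (P.decay x) + 2) * ε) (Real.log (P.decay x)) := by
    have h2 : HasDerivAt (fun s : ℝ => ε * s + 2) ε (Real.log (P.decay x)) := by
      simpa using ((hasDerivAt_id (Real.log (P.decay x))).const_mul ε).add_const 2
    exact ((Real.smoothTransition.contDiff (n := 1)).differentiable (by simp) _).hasDerivAt.comp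
      (Real.log (P.decay x)) h2
  exact hasGradientAt_comp (f := fun s : ℝ => Real.smoothTransition (ε * s + 2)) h1
    (hasGradientAt_log_decay hx)

/-- The denominator (1 + |x|²)² forces decay at infinity even when the domain is unbounded, so these
superlevel sets are bounded; for s > 0 they also stay off the boundary. -/
theorem isCompact_decay_ge (hN : 2 ≤ N) (hn : 2 ≤ n) (P : PoleData N n) {s : ℝ} (hs : 0 < s) :
    IsCompact {x | s ≤ P.decay x} := by
  obtain ⟨C, hC, -, h⟩ := exists_estimates hN hn P
  refine Metric.isCompact_of_isClosed_isBounded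
    (isClosed_le continuous_const P.contDiff_decay.continuous) ?_
  refine (Metric.isBounded_closedBall (x := (0 : E N)) (r := C / s)).subset fun x hx => ?_
  have hx' : s ≤ P.decay x := hx
  have h1 := hx'.trans (h x (mem_domain_of_decay_pos (hs.trans_le hx')))
  rw [mem_closedBall_zero_iff, le_div_iff₀ hs]
  rw [le_div_iff₀ (by positivity)] at h1
  nlinarith [norm_nonneg x, mul_nonneg hs.le (norm_nonneg x), mul_nonneg hs.le (sq_nonneg ‖x‖)]

/-- The shift by 2 makes the cut-off vanish where d < exp(-2/ε), so the truncation is supported in a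
compact superlevel set. At a fixed point the argument tends to 2 as ε → 0, beyond the end 1 of the
transition. -/
theorem exists_test (hN : 2 ≤ N) (hn : 2 ≤ n) (P : PoleData N n) {ε : ℝ} (hε : 0 < ε) :
    ∃ u : TestFunction P.domain ℝ ⊤,
      ∀ x ∈ P.domain, u x = P.cutoff ε x * P.groundState x := by
  let s : ℝ := Real.exp (-2 / ε)
  have hs : 0 < s := Real.exp_pos _
  have heq : ∀ x ∈ P.domain, Set.indicator (P.domain : Set (E N))
      (fun x => P.cutoff ε x * P.groundState x) x = P.cutoff ε x * P.groundState x :=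
    fun x hx => Set.indicator_of_mem hx _
  refine ⟨testOf P.domain (Set.indicator (P.domain : Set (E N))
      (fun x => P.cutoff ε x * P.groundState x))
    (((P.contDiffOn_cutoff ε).mul P.contDiffOn_groundState).congr heq) {x | s ≤ P.decay x}
    (P.isCompact_decay_ge hN hn hs) (fun x hx => mem_domain_of_decay_pos (hs.trans_le hx))
    fun x hx => ?_, heq⟩
  by_cases hxΩ : x ∈ P.domain
  · rw [heq x hxΩ, cutoff, Real.smoothTransition.zero_of_nonpos, zero_mul]
    have h1 : Real.log (P.decay x) < -2 / ε := by
      rw [Real.log_lt_iff_lt_exp (decay_pos hxΩ)]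
      exact not_le.1 hx
    rw [lt_div_iff₀ hε] at h1
    linarith
  · exact Set.indicator_of_notMem hxΩ _

/-- Because ∇φ = φb, subtracting ub removes the term in which φ is differentiated and leaves φ times
the gradient of the cut-off. -/
theorem gradient_test {ε : ℝ} {u : TestFunction P.domain ℝ ⊤}
    (hu : ∀ x ∈ P.domain, u x = P.cutoff ε x * P.groundState x) (hx : x ∈ P.domain) :
    gradient u x - u x • P.logGrad x =
      (P.groundState x * (deriv Real.smoothTransition (ε * Real.log (P.decay x) + 2) * ε)) •
        P.decayGrad x := by
  have h := hasGradientAt_mul (hasGradientAt_cutoff hx ε) (hasGradientAt_groundState hx)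
  rw [hasGradientAt_iff_hasFDerivAt] at h
  have h' := h.congr_of_eventuallyEq (f₁ := u) (by
    filter_upwards [P.domain.isOpen.mem_nhds hx] with y hy using hu y hy)
  rw [← hasGradientAt_iff_hasFDerivAt] at h'
  rw [h'.gradient, hu x hx, smul_smul, smul_smul, add_sub_cancel_left]

/-- The squared cut-off gradient carries ε², and the singularity t^(-N), regularized to the kernel
with s = 2ε, integrates to O(1/ε). -/
theorem exists_lintegral_remainder_le (hN : 2 ≤ N) (hn : 2 ≤ n) (P : PoleData N n) :
    ∃ D : ℝ, ∀ ε, 0 < ε → ε ≤ 1 → ∀ u : TestFunction P.domain ℝ ⊤,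
      (∀ x ∈ P.domain, u x = P.cutoff ε x * P.groundState x) →
      ∫⁻ x in (P.domain : Set (E N)), ENNReal.ofReal (‖gradient u x - u x • P.logGrad x‖ ^ 2) ≤
        ENNReal.ofReal (D * ε) := by
  obtain ⟨C, hC, hest, -⟩ := exists_estimates hN hn P
  obtain ⟨M, hM0, hM, hMneg⟩ := exists_abs_deriv_smoothTransition_le
  obtain ⟨C', hC', hker⟩ := exists_lintegral_radialKernel_le (N := N) (by omega)
  have hC0 : 0 < C := by linarith
  refine ⟨M ^ 2 * Real.exp 4 * C ^ 3 * n * (C' / 2), fun ε hε hε1 u hu => ?_⟩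
  have hpt : ∀ x ∈ P.domain, ‖gradient u x - u x • P.logGrad x‖ ^ 2 ≤
      ε ^ 2 * (M ^ 2 * Real.exp 4 * C ^ 3) * ∑ i, radialKernel N (2 * ε) ‖x - P.pole i‖ := by
    intro x hx
    obtain ⟨k, hk1, hk2, -⟩ := hest x hx
    have hpos : ∀ i, 0 ≤ radialKernel N (2 * ε) ‖x - P.pole i‖ :=
      fun i => radialKernel_nonneg _ _ (norm_nonneg _)
    have ht := norm_sub_pole_pos hx k
    rw [gradient_test hu hx, norm_smul, mul_pow, Real.norm_eq_abs, sq_abs]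
    rcases lt_or_ge (ε * Real.log (P.decay x) + 2) 0 with h0 | h0
    · rw [hMneg _ h0]
      have := Finset.sum_nonneg fun i (_ : i ∈ Finset.univ) => hpos i
      simp only [zero_mul, mul_zero, ne_eq, OfNat.ofNat_ne_zero, not_false_eq_true, zero_pow]
      positivity
    · set d := deriv Real.smoothTransition (ε * Real.log (P.decay x) + 2) with hd
      have hd2 : d ^ 2 ≤ M ^ 2 := by
        rw [← sq_abs]
        exact pow_le_pow_left₀ (abs_nonneg _) (hM _) 2
      have hdec := decay_pos hx
      -- Where the cut-off varies, d ≥ exp(-2/ε), hence d^(2ε) ≥ exp(-4). Inserting this factor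
      -- turns the nonintegrable t^(-N) into the integrable kernel.
      have h1 : 1 ≤ Real.exp 4 * P.decay x ^ (2 * ε) := by
        rw [Real.rpow_def_of_pos hdec, ← Real.exp_add]
        refine Real.one_le_exp ?_
        linarith
      have h2 : P.decay x ^ (2 * ε) ≤
          C ^ 2 * (‖x - P.pole k‖ / (1 + ‖x - P.pole k‖) ^ 2) ^ (2 * ε) := by
        refine (Real.rpow_le_rpow hdec.le hk2 (by linarith)).trans ?_
        rw [Real.mul_rpow hC0.le (by positivity)]
        refine mul_le_mul_of_nonneg_right ?_ (by positivity)
        -- C^(2ε) ≤ C² uses C ≥ 1 and ε ≤ 1; it makes the constant independent of ε.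
        rw [← Real.rpow_natCast]
        exact Real.rpow_le_rpow_of_exponent_le hC (by push_cast; linarith)
      have h3 : P.groundState x ^ 2 * ‖P.decayGrad x‖ ^ 2 ≤
          Real.exp 4 * C ^ 3 * radialKernel N (2 * ε) ‖x - P.pole k‖ := by
        calc P.groundState x ^ 2 * ‖P.decayGrad x‖ ^ 2
            ≤ C * ‖x - P.pole k‖ ^ (-(N : ℝ)) * 1 := by rw [mul_one]; exact hk1
          _ ≤ C * ‖x - P.pole k‖ ^ (-(N : ℝ)) * (Real.exp 4 * (C ^ 2 *
                (‖x - P.pole k‖ / (1 + ‖x - P.pole k‖) ^ 2) ^ (2 * ε))) := by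
              refine mul_le_mul_of_nonneg_left (h1.trans ?_) (by positivity)
              exact mul_le_mul_of_nonneg_left h2 (Real.exp_pos _).le
          _ = _ := by rw [radialKernel]; ring
      calc (P.groundState x * (d * ε)) ^ 2 * ‖P.decayGrad x‖ ^ 2
          = ε ^ 2 * (d ^ 2 * (P.groundState x ^ 2 * ‖P.decayGrad x‖ ^ 2)) := by ring
        _ ≤ ε ^ 2 * (M ^ 2 * (Real.exp 4 * C ^ 3 * radialKernel N (2 * ε) ‖x - P.pole k‖)) := by
            refine mul_le_mul_of_nonneg_left ?_ (sq_nonneg _)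
            exact mul_le_mul hd2 h3 (by positivity) (sq_nonneg _)
        _ = ε ^ 2 * (M ^ 2 * Real.exp 4 * C ^ 3) * radialKernel N (2 * ε) ‖x - P.pole k‖ := by ring
        _ ≤ _ := by
            refine mul_le_mul_of_nonneg_left ?_ (by positivity)
            exact Finset.single_le_sum (f := fun i => radialKernel N (2 * ε) ‖x - P.pole i‖)
              (fun i _ => hpos i) (Finset.mem_univ k)
  calc _ ≤ ∫⁻ x in (P.domain : Set (E N)), ENNReal.ofReal (ε ^ 2 * (M ^ 2 * Real.exp 4 * C ^ 3)) *
          ∑ i, ENNReal.ofReal (radialKernel N (2 * ε) ‖x - P.pole i‖) := by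
        refine setLIntegral_mono' P.domain.isOpen.measurableSet fun x hx => ?_
        rw [← ENNReal.ofReal_sum_of_nonneg fun i _ => radialKernel_nonneg _ _ (norm_nonneg _),
          ← ENNReal.ofReal_mul (by positivity)]
        exact ENNReal.ofReal_le_ofReal (hpt x hx)
    _ ≤ ∫⁻ x, ENNReal.ofReal (ε ^ 2 * (M ^ 2 * Real.exp 4 * C ^ 3)) *
          ∑ i, ENNReal.ofReal (radialKernel N (2 * ε) ‖x - P.pole i‖) := setLIntegral_le_lintegral _ _
    _ = ENNReal.ofReal (ε ^ 2 * (M ^ 2 * Real.exp 4 * C ^ 3)) *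
          ∑ i, ∫⁻ x, ENNReal.ofReal (radialKernel N (2 * ε) ‖x - P.pole i‖) := by
        rw [lintegral_const_mul' _ _ ENNReal.ofReal_ne_top, lintegral_finsetSum]
        intro i _
        unfold radialKernel
        fun_prop
    _ ≤ ENNReal.ofReal (ε ^ 2 * (M ^ 2 * Real.exp 4 * C ^ 3)) *
          ∑ i : Fin n, ENNReal.ofReal (C' / (2 * ε)) := by
        gcongr with i
        exact hker (2 * ε) (by linarith) _
    _ = _ := by
        rw [← ENNReal.ofReal_sum_of_nonneg fun i _ => by positivity,
          ← ENNReal.ofReal_mul (by positivity)]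
        congr 1
        simp only [Finset.sum_const, Finset.card_univ, Fintype.card_fin, nsmul_eq_mul]
        field_simp

/-- The truncations of the ground state. -/
theorem exists_seq_test (hN : 2 ≤ N) (hn : 2 ≤ n) (P : PoleData N n) :
    ∃ u : ℕ → TestFunction P.domain ℝ ⊤,
      (∀ k, ∀ x ∈ P.domain, 0 ≤ u k x ∧ u k x ≤ P.groundState x) ∧
      (∀ x ∈ P.domain, Tendsto (fun k => u k x) atTop (𝓝 (P.groundState x))) ∧
      (∀ x ∈ P.domain, Tendsto (fun k => gradient (u k) x) atTop
        (𝓝 (P.groundState x • P.logGrad x))) ∧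
      Tendsto (fun k => ∫⁻ x in (P.domain : Set (E N)),
        ENNReal.ofReal (‖gradient (u k) x - u k x • P.logGrad x‖ ^ 2)) atTop (𝓝 0) := by
  obtain ⟨D, hD⟩ := exists_lintegral_remainder_le hN hn P
  obtain ⟨M, hM0, hM, -⟩ := exists_abs_deriv_smoothTransition_le
  have hε : ∀ k : ℕ, (0 : ℝ) < 1 / ((k : ℝ) + 1) := fun k => Nat.one_div_pos_of_nat
  choose u hu using fun k : ℕ => exists_test hN hn P (hε k)
  have hlim := tendsto_one_div_add_atTop_nhds_zero_nat (𝕜 := ℝ)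
  have h2 : ∀ x ∈ P.domain, Tendsto (fun k => u k x) atTop (𝓝 (P.groundState x)) := by
    intro x hx
    have h3 : Tendsto (fun k : ℕ => P.cutoff (1 / ((k : ℝ) + 1)) x * P.groundState x) atTop
        (𝓝 (Real.smoothTransition (0 * Real.log (P.decay x) + 2) * P.groundState x)) :=
      ((Real.smoothTransition.continuous.tendsto _).comp
        ((hlim.mul_const _).add_const _)).mul_const _
    rw [zero_mul, zero_add, Real.smoothTransition.one_of_one_le (by norm_num), one_mul] at h3
    exact h3.congr fun k => (hu k x hx).symm
  refine ⟨u, fun k x hx => ?_, h2, fun x hx => ?_, ?_⟩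
  · rw [hu k x hx]
    exact ⟨mul_nonneg (Real.smoothTransition.nonneg _) (groundState_pos hx).le,
      mul_le_of_le_one_left (groundState_pos hx).le (Real.smoothTransition.le_one _)⟩
  · have h4 : Tendsto (fun k => gradient (u k) x - u k x • P.logGrad x) atTop (𝓝 0) := by
      have hs : Tendsto (fun k : ℕ => deriv Real.smoothTransition
          (1 / ((k : ℝ) + 1) * Real.log (P.decay x) + 2) * (1 / ((k : ℝ) + 1))) atTop (𝓝 0) := by
        have hM' : Tendsto (fun k : ℕ => M * (1 / ((k : ℝ) + 1))) atTop (𝓝 0) := by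
          simpa using hlim.const_mul M
        refine squeeze_zero_norm (fun k => ?_) hM'
        rw [norm_mul, Real.norm_of_nonneg (hε k).le]
        exact mul_le_mul_of_nonneg_right (hM _) (hε k).le
      have := (hs.const_mul (P.groundState x)).smul_const (P.decayGrad x)
      rw [mul_zero, zero_smul] at this
      exact this.congr fun k => (gradient_test (hu k) hx).symm
    have := h4.add ((h2 x hx).smul_const (P.logGrad x))
    simpa using this
  · refine tendsto_of_tendsto_of_tendsto_of_le_of_le tendsto_const_nhds
      (h := fun k : ℕ => ENNReal.ofReal (D * (1 / ((k : ℝ) + 1)))) ?_ (fun _ => zero_le)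
      fun k => hD _ (hε k) ?_ (u k) (hu k)
    · have := ENNReal.tendsto_ofReal (hlim.const_mul D)
      simpa using this
    · rw [div_le_one (by positivity)]
      linarith [Nat.cast_nonneg (α := ℝ) k]

/-! ### The value of the Hardy constant -/

theorem potential_pos (hn : 2 ≤ n) (hx : x ∈ P.domain) : 0 < potential P.pole x := by
  have h01 : (⟨0, by omega⟩ : Fin n) < ⟨1, by omega⟩ := by simp
  have hnn : ∀ i j, 0 ≤ ‖P.pole i - P.pole j‖ ^ 2 / (‖x - P.pole i‖ ^ 2 * ‖x - P.pole j‖ ^ 2) :=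
    fun i j => by positivity
  refine Finset.sum_pos' (fun i _ => Finset.sum_nonneg fun j _ => hnn i j)
    ⟨⟨0, by omega⟩, Finset.mem_univ _, ?_⟩
  refine Finset.sum_pos' (fun j _ => hnn _ j) ⟨⟨1, by omega⟩, Finset.mem_Ioi.2 h01, ?_⟩
  have h1 : 0 < ‖P.pole ⟨0, by omega⟩ - P.pole ⟨1, by omega⟩‖ :=
    norm_pos_iff.2 (sub_ne_zero.2 fun h => h01.ne (P.injective h))
  have h2 := norm_sub_pole_pos hx
  have h3 := h2 ⟨0, by omega⟩
  have h4 := h2 ⟨1, by omega⟩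
  positivity

theorem aestronglyMeasurable_potential (P : PoleData N n) :
    AEStronglyMeasurable (potential P.pole) (volume.restrict P.domain) :=
  P.continuousOn_potential.aestronglyMeasurable P.domain.isOpen.measurableSet

theorem aestronglyMeasurable_logGrad (P : PoleData N n) :
    AEStronglyMeasurable P.logGrad (volume.restrict P.domain) :=
  P.contDiffOn_logGrad.continuousOn.aestronglyMeasurable P.domain.isOpen.measurableSet

theorem lintegral_remainder_add {u : E N → ℝ} {G : E N → E N}
    (hu : AEStronglyMeasurable u (volume.restrict P.domain))
    (hG : AEStronglyMeasurable G (volume.restrict P.domain)) :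
    ∫⁻ x in (P.domain : Set (E N)), ENNReal.ofReal (‖G x - u x • P.logGrad x‖ ^ 2 +
        P.expo ^ 2 * potential P.pole x * u x ^ 2) =
      (∫⁻ x in (P.domain : Set (E N)), ENNReal.ofReal (‖G x - u x • P.logGrad x‖ ^ 2)) +
      ENNReal.ofReal (P.expo ^ 2) *
        ∫⁻ x in (P.domain : Set (E N)), ENNReal.ofReal (potential P.pole x * u x ^ 2) := by
  rw [← lintegral_const_mul' _ _ ENNReal.ofReal_ne_top, ← lintegral_add_left']
  · refine lintegral_congr fun x => ?_
    have := potential_nonneg P.pole x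
    rw [ENNReal.ofReal_add (by positivity) (by positivity), mul_assoc,
      ENNReal.ofReal_mul (p := P.expo ^ 2) (by positivity)]
  · exact (((hG.sub (hu.smul P.aestronglyMeasurable_logGrad)).norm.pow 2).aemeasurable).ennreal_ofReal

theorem lintegral_potential_ne_zero (hn : 2 ≤ n) {u : E N → ℝ}
    (hu : AEStronglyMeasurable u (volume.restrict P.domain)) (h : Nontrivial P.domain u) :
    ∫⁻ x in (P.domain : Set (E N)), ENNReal.ofReal (potential P.pole x * u x ^ 2) ≠ 0 := by
  intro h0
  rw [lintegral_eq_zero_iff'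
    (P.aestronglyMeasurable_potential.fun_mul (hu.fun_pow 2)).aemeasurable.ennreal_ofReal] at h0
  refine h ?_
  filter_upwards [h0, ae_restrict_mem P.domain.isOpen.measurableSet] with x hx hxΩ
  simp only [Pi.zero_apply, ENNReal.ofReal_eq_zero] at hx ⊢
  have hV := potential_pos hn hxΩ
  by_contra hne
  have : 0 < potential P.pole x * u x ^ 2 := by positivity
  linarith

theorem lintegral_grad_ne_top {Ω : Opens (E N)} {u : E N → ℝ} {G : E N → E N}
    (h : MemD12 Ω u G) : ∫⁻ x in (Ω : Set (E N)), ENNReal.ofReal (‖G x‖ ^ 2) ≠ ⊤ := by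
  rw [← eLpNorm_two_sq]
  exact ENNReal.pow_ne_top h.memLp_grad.eLpNorm_ne_top

theorem lintegral_remainder_add_le (hn : n ≠ 0) {u : E N → ℝ} {G : E N → E N}
    (h : MemD12 P.domain u G) :
    (∫⁻ x in (P.domain : Set (E N)), ENNReal.ofReal (‖G x - u x • P.logGrad x‖ ^ 2)) +
      ENNReal.ofReal (P.expo ^ 2) *
        ∫⁻ x in (P.domain : Set (E N)), ENNReal.ofReal (potential P.pole x * u x ^ 2) ≤
      ∫⁻ x in (P.domain : Set (E N)), ENNReal.ofReal (‖G x‖ ^ 2) := by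
  rw [← lintegral_remainder_add h.aestronglyMeasurable h.memLp_grad.1]
  exact (P.isRiccatiField hn).lintegral_le_of_memD12 h

theorem le_hardyConstant (hn : 2 ≤ n) (P : PoleData N n) :
    ENNReal.ofReal (P.expo ^ 2) ≤ hardyConstant P.domain P.pole := by
  refine le_sInf ?_
  rintro q ⟨u, G, hu, hnt, rfl⟩
  rw [quotient, ENNReal.le_div_iff_mul_le
    (Or.inl (lintegral_potential_ne_zero hn hu.aestronglyMeasurable hnt))
    (Or.inr (lintegral_grad_ne_top hu))]
  exact le_add_self.trans (lintegral_remainder_add_le (by omega) hu)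

theorem lintegral_gradient_test (hn : n ≠ 0) (u : TestFunction P.domain ℝ ⊤) :
    ∫⁻ x in (P.domain : Set (E N)), ENNReal.ofReal (‖gradient u x‖ ^ 2) =
      (∫⁻ x in (P.domain : Set (E N)), ENNReal.ofReal (‖gradient u x - u x • P.logGrad x‖ ^ 2)) +
      ENNReal.ofReal (P.expo ^ 2) *
        ∫⁻ x in (P.domain : Set (E N)), ENNReal.ofReal (potential P.pole x * u x ^ 2) := by
  rw [← lintegral_remainder_add u.continuous.aestronglyMeasurable
    (testFunction_continuous_gradient u).aestronglyMeasurable]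
  exact (P.isRiccatiField hn).lintegral_gradient u

theorem nontrivial_of_pos (hne : (P.domain : Set (E N)).Nonempty) {u : E N → ℝ}
    (hu : ∀ x ∈ P.domain, 0 < u x) : Nontrivial P.domain u := by
  intro h
  have h1 : ∀ᵐ x ∂volume.restrict (P.domain : Set (E N)), False := by
    filter_upwards [h, ae_restrict_mem P.domain.isOpen.measurableSet] with x hx hxΩ
    exact (hu x hxΩ).ne' hx
  rw [eventually_false_iff_eq_bot, ae_eq_bot, Measure.restrict_eq_zero] at h1
  exact (P.domain.isOpen.measure_pos volume hne).ne' h1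

theorem aestronglyMeasurable_groundState (P : PoleData N n) :
    AEStronglyMeasurable P.groundState (volume.restrict P.domain) :=
  P.contDiffOn_groundState.continuousOn.aestronglyMeasurable P.domain.isOpen.measurableSet

theorem lintegral_groundState_ne_zero (hn : 2 ≤ n) (hne : (P.domain : Set (E N)).Nonempty) :
    ∫⁻ x in (P.domain : Set (E N)),
      ENNReal.ofReal (potential P.pole x * P.groundState x ^ 2) ≠ 0 :=
  lintegral_potential_ne_zero hn P.aestronglyMeasurable_groundState
    (nontrivial_of_pos hne fun _ hx => groundState_pos hx)

/-- On the truncations the quotient is at most β² plus the remainder divided by ∫Vu_k². The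
remainder tends to 0, and by Fatou's lemma the denominators stay above a positive number. -/
theorem hardyConstant_le (hN : 2 ≤ N) (hn : 2 ≤ n) (P : PoleData N n)
    (hne : (P.domain : Set (E N)).Nonempty) :
    hardyConstant P.domain P.pole ≤ ENNReal.ofReal (P.expo ^ 2) := by
  obtain ⟨u, -, hu, -, hrem⟩ := exists_seq_test hN hn P
  set B : ℕ → ℝ≥0∞ := fun k =>
    ∫⁻ x in (P.domain : Set (E N)), ENNReal.ofReal (potential P.pole x * u k x ^ 2) with hB
  have hfatou : ∫⁻ x in (P.domain : Set (E N)),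
      ENNReal.ofReal (potential P.pole x * P.groundState x ^ 2) ≤ liminf B atTop := by
    refine le_trans (lintegral_mono_ae ?_) (lintegral_liminf_le' fun k =>
      (P.aestronglyMeasurable_potential.mul
        ((u k).continuous.aestronglyMeasurable.pow 2)).aemeasurable.ennreal_ofReal)
    filter_upwards [ae_restrict_mem P.domain.isOpen.measurableSet] with x hx
    refine (Tendsto.liminf_eq ?_).ge
    exact ENNReal.tendsto_ofReal (((hu x hx).pow 2).const_mul _)
  -- The integral ∫Vφ² may be infinite, so a finite positive b below it serves as the lower bound
  -- for the denominators.
  obtain ⟨b, hb0, hb⟩ := exists_between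
    (pos_iff_ne_zero.2 (lintegral_groundState_ne_zero (P := P) hn hne))
  have hev : ∀ᶠ k in atTop, b < B k := eventually_lt_of_lt_liminf (hb.trans_le hfatou)
  have hbt : b ≠ ⊤ := (hb.trans_le le_top).ne
  have hlim := ((ENNReal.Tendsto.div_const hrem (Or.inr hb0.ne')).const_add
    (ENNReal.ofReal (P.expo ^ 2)))
  rw [ENNReal.zero_div, add_zero] at hlim
  refine ge_of_tendsto hlim ?_
  filter_upwards [hev] with k hk
  have hnt : Nontrivial P.domain (u k) := by
    intro h0
    refine (hb0.trans hk).ne' ?_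
    refine lintegral_eq_zero_of_ae_eq_zero ?_
    filter_upwards [h0] with x hx
    simp [hx]
  have hmem : hardyConstant P.domain P.pole ≤ quotient P.domain P.pole (u k) (gradient (u k)) :=
    sInf_le ⟨u k, _, memD12_testFunction (u k), hnt, rfl⟩
  refine hmem.trans ?_
  rw [quotient]
  refine ENNReal.div_le_of_le_mul ?_
  rw [lintegral_gradient_test (by omega), add_mul, add_comm]
  refine add_le_add le_rfl ?_
  calc _ = _ / b * b := (ENNReal.div_mul_cancel hb0.ne' hbt).symm
    _ ≤ _ := mul_le_mul_right hk.le _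

theorem hardyConstant_eq (hN : 2 ≤ N) (hn : 2 ≤ n) (P : PoleData N n)
    (hne : (P.domain : Set (E N)).Nonempty) :
    hardyConstant P.domain P.pole = ENNReal.ofReal (P.expo ^ 2) :=
  le_antisymm (P.hardyConstant_le hN hn hne) (P.le_hardyConstant hn)

/-! ### Finite energy and attainment for three or more poles -/

/-- For at least three poles the ground state has finite energy. -/
theorem lintegral_groundState_ne_top (hN : 2 ≤ N) (hn : 3 ≤ n) (P : PoleData N n) :
    ∫⁻ x in (P.domain : Set (E N)),
      ENNReal.ofReal (potential P.pole x * P.groundState x ^ 2) ≠ ⊤ := by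
  obtain ⟨C, hC, hest, -⟩ := exists_estimates hN (by omega) P
  obtain ⟨C', hC', hker⟩ := exists_lintegral_radialKernel_le (N := N) (by omega)
  -- This is where n ≥ 3 enters: N - 2N/n > 0, so the kernel that dominates Vφ² is integrable.
  have hs : 0 < (N : ℝ) - 2 * P.expo := by
    have h1 := P.expo_mul (by omega)
    have h2 : (3 : ℝ) ≤ n := by exact_mod_cast hn
    have h3 : (0 : ℝ) < N := by positivity
    have h4 : 0 < P.expo := by unfold expo; positivity
    have h5 := mul_le_mul_of_nonneg_left h2 h4.le
    linarith
  set s := (N : ℝ) - 2 * P.expo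
  have hpos : ∀ x i, 0 ≤ radialKernel N s ‖x - P.pole i‖ :=
    fun x i => radialKernel_nonneg _ _ (norm_nonneg _)
  refine ne_top_of_le_ne_top (b := ENNReal.ofReal C * ∑ i : Fin n, ENNReal.ofReal (C' / s)) ?_ ?_
  · exact ENNReal.mul_ne_top ENNReal.ofReal_ne_top
      (ENNReal.sum_ne_top.2 fun i _ => ENNReal.ofReal_ne_top)
  calc _ ≤ ∫⁻ x in (P.domain : Set (E N)), ENNReal.ofReal C *
          ∑ i, ENNReal.ofReal (radialKernel N s ‖x - P.pole i‖) := by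
        refine setLIntegral_mono' P.domain.isOpen.measurableSet fun x hx => ?_
        rw [← ENNReal.ofReal_sum_of_nonneg fun i _ => hpos x i,
          ← ENNReal.ofReal_mul (by positivity)]
        obtain ⟨k, -, -, hk⟩ := hest x hx
        refine ENNReal.ofReal_le_ofReal (hk.trans (mul_le_mul_of_nonneg_left ?_ (by positivity)))
        exact Finset.single_le_sum (f := fun i => radialKernel N s ‖x - P.pole i‖)
              (fun i _ => hpos x i) (Finset.mem_univ k)
    _ ≤ ∫⁻ x, ENNReal.ofReal C * ∑ i, ENNReal.ofReal (radialKernel N s ‖x - P.pole i‖) :=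
        setLIntegral_le_lintegral _ _
    _ = ENNReal.ofReal C * ∑ i, ∫⁻ x, ENNReal.ofReal (radialKernel N s ‖x - P.pole i‖) := by
        rw [lintegral_const_mul' _ _ ENNReal.ofReal_ne_top, lintegral_finsetSum]
        intro i _
        unfold radialKernel
        fun_prop
    _ ≤ _ := by
        gcongr with i
        exact hker s hs _

/-- The gradient of the ground state. -/
def groundGrad (P : PoleData N n) (x : E N) : E N := P.groundState x • P.logGrad x

theorem aestronglyMeasurable_groundGrad (P : PoleData N n) :
    AEStronglyMeasurable P.groundGrad (volume.restrict P.domain) :=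
  P.aestronglyMeasurable_groundState.smul P.aestronglyMeasurable_logGrad

/-- Fatou's lemma for the gradients of the truncations: since 0 ≤ u_k ≤ φ, their energy is at most
the vanishing remainder plus β² ∫Vφ². The reverse inequality is the Hardy inequality, available once
φ is known to be in D^{1,2}. -/
theorem lintegral_groundGrad_le (hN : 2 ≤ N) (hn : 2 ≤ n) (P : PoleData N n) :
    ∫⁻ x in (P.domain : Set (E N)), ENNReal.ofReal (‖P.groundGrad x‖ ^ 2) ≤
      ENNReal.ofReal (P.expo ^ 2) * ∫⁻ x in (P.domain : Set (E N)),
        ENNReal.ofReal (potential P.pole x * P.groundState x ^ 2) := by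
  obtain ⟨u, hu0, hu, hgu, hrem⟩ := exists_seq_test hN hn P
  set B := ∫⁻ x in (P.domain : Set (E N)),
    ENNReal.ofReal (potential P.pole x * P.groundState x ^ 2)
  have hle : ∀ k, ∫⁻ x in (P.domain : Set (E N)), ENNReal.ofReal (‖gradient (u k) x‖ ^ 2) ≤
      (∫⁻ x in (P.domain : Set (E N)),
        ENNReal.ofReal (‖gradient (u k) x - u k x • P.logGrad x‖ ^ 2)) +
      ENNReal.ofReal (P.expo ^ 2) * B := by
    intro k
    rw [lintegral_gradient_test (by omega)]
    refine add_le_add le_rfl (mul_le_mul_right ?_ _)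
    refine setLIntegral_mono' P.domain.isOpen.measurableSet fun x hx => ?_
    refine ENNReal.ofReal_le_ofReal (mul_le_mul_of_nonneg_left ?_ (potential_nonneg _ _))
    exact pow_le_pow_left₀ (hu0 k x hx).1 (hu0 k x hx).2 2
  have hlim := hrem.add_const (ENNReal.ofReal (P.expo ^ 2) * B)
  rw [zero_add] at hlim
  calc _ ≤ ∫⁻ x in (P.domain : Set (E N)),
        liminf (fun k => ENNReal.ofReal (‖gradient (u k) x‖ ^ 2)) atTop := by
        refine lintegral_mono_ae ?_
        filter_upwards [ae_restrict_mem P.domain.isOpen.measurableSet] with x hx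
        refine (Tendsto.liminf_eq ?_).ge
        exact ENNReal.tendsto_ofReal ((hgu x hx).norm.pow 2)
    _ ≤ liminf (fun k => ∫⁻ x in (P.domain : Set (E N)),
        ENNReal.ofReal (‖gradient (u k) x‖ ^ 2)) atTop :=
        lintegral_liminf_le' fun k =>
          ((testFunction_continuous_gradient (u k)).norm.pow 2).measurable.ennreal_ofReal.aemeasurable
    _ ≤ _ := (liminf_le_liminf (Eventually.of_forall hle)).trans_eq hlim.liminf_eq

theorem memLp_two_of_lintegral_ne_top {F : Type*} [NormedAddCommGroup F] {μ : Measure (E N)}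
    {f : E N → F} (hf : AEStronglyMeasurable f μ)
    (h : ∫⁻ x, ENNReal.ofReal (‖f x‖ ^ 2) ∂μ ≠ ⊤) : MemLp f 2 μ := by
  refine ⟨hf, ?_⟩
  rw [← eLpNorm_two_sq] at h
  exact lt_top_iff_ne_top.2 fun h' => h (by rw [h']; simp)

theorem memLp_two_of_continuousOn {K : Set (E N)} (hK : IsCompact K) {f : E N → ℝ}
    (hf : ContinuousOn f K) : MemLp f 2 (volume.restrict K) := by
  obtain ⟨C, hC⟩ := hK.exists_bound_of_continuousOn hf
  have : IsFiniteMeasure (volume.restrict K) := ⟨by simpa using hK.measure_lt_top⟩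
  refine MemLp.of_bound (hf.aestronglyMeasurable hK.measurableSet) C ?_
  filter_upwards [ae_restrict_mem hK.measurableSet] with x hx using hC x hx

theorem tendsto_eLpNorm_of_lintegral {F : Type*} [NormedAddCommGroup F] {μ : Measure (E N)}
    {f : ℕ → E N → F} (h : Tendsto (fun k => ∫⁻ x, ENNReal.ofReal (‖f k x‖ ^ 2) ∂μ) atTop (𝓝 0)) :
    Tendsto (fun k => eLpNorm (f k) 2 μ) atTop (𝓝 0) := by
  simp_rw [← eLpNorm_two_sq] at h
  have := h.ennrpow_const (1 / 2)
  rw [ENNReal.zero_rpow_of_pos (by norm_num)] at this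
  refine this.congr fun k => ?_
  rw [← ENNReal.rpow_natCast, ← ENNReal.rpow_mul]
  norm_num

/-- Truncations converge in `L²`, by dominated convergence. -/
theorem tendsto_eLpNorm_of_dominated {F : Type*} [NormedAddCommGroup F] {μ : Measure (E N)}
    {f : ℕ → E N → F} {g : E N → ℝ} (hf : ∀ k, AEStronglyMeasurable (f k) μ)
    (hg : MemLp g 2 μ) (hfg : ∀ k, ∀ᵐ x ∂μ, ‖f k x‖ ≤ ‖g x‖)
    (hlim : ∀ᵐ x ∂μ, Tendsto (fun k => f k x) atTop (𝓝 0)) :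
    Tendsto (fun k => eLpNorm (f k) 2 μ) atTop (𝓝 0) := by
  refine tendsto_eLpNorm_of_lintegral ?_
  have := tendsto_lintegral_of_dominated_convergence' (μ := μ)
    (F := fun k x => ENNReal.ofReal (‖f k x‖ ^ 2)) (f := fun _ => 0)
    (fun x => ENNReal.ofReal (‖g x‖ ^ 2)) (fun k => ((hf k).norm.pow 2).aemeasurable.ennreal_ofReal)
    (fun k => by
      filter_upwards [hfg k] with x hx
      exact ENNReal.ofReal_le_ofReal (pow_le_pow_left₀ (norm_nonneg _) hx 2))
    (by rw [← eLpNorm_two_sq]; exact ENNReal.pow_ne_top hg.eLpNorm_ne_top)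
    (by
      filter_upwards [hlim] with x hx
      have := ENNReal.tendsto_ofReal (hx.norm.pow 2)
      simpa using this)
  simpa using this

theorem memLp_groundGrad (hN : 2 ≤ N) (hn : 3 ≤ n) (P : PoleData N n) :
    MemLp P.groundGrad 2 (volume.restrict P.domain) :=
  memLp_two_of_lintegral_ne_top P.aestronglyMeasurable_groundGrad
    (ne_top_of_le_ne_top (ENNReal.mul_ne_top ENNReal.ofReal_ne_top
      (P.lintegral_groundState_ne_top hN hn)) (P.lintegral_groundGrad_le hN (by omega)))

theorem isWeakGradient_groundState (P : PoleData N n) :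
    IsWeakGradient P.domain P.groundState P.groundGrad :=
  isWeakGradient_of_contDiffOn P.contDiffOn_groundState fun _ hx => hasGradientAt_groundState hx

/-- The difference of gradients is (∇u_k - u_k b) + (u_k - φ)b. The first part is the remainder; the
second is dominated by |∇φ|, which is in L². The set s is left free so that compact sets serve for
D^{1,2} and the whole domain for H¹₀. -/
theorem exists_approx_groundState (hN : 2 ≤ N) (hn : 3 ≤ n) (P : PoleData N n) :
    ∃ u : ℕ → TestFunction P.domain ℝ ⊤,
      (∀ s : Set (E N), MeasurableSet s → s ⊆ P.domain →
        MemLp P.groundState 2 (volume.restrict s) →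
        Tendsto (fun k => eLpNorm (fun x => u k x - P.groundState x) 2 (volume.restrict s))
          atTop (𝓝 0)) ∧
      Tendsto (fun k => eLpNorm (fun x => gradient (u k) x - P.groundGrad x) 2
        (volume.restrict P.domain)) atTop (𝓝 0) := by
  obtain ⟨u, hu0, hu, hgu, hrem⟩ := exists_seq_test hN (by omega) P
  have hms := P.domain.isOpen.measurableSet
  refine ⟨u, fun s hs hsΩ hφ => ?_, ?_⟩
  · refine tendsto_eLpNorm_of_dominated
      (fun k => (u k).continuous.aestronglyMeasurable.sub hφ.1) hφ (fun k => ?_) ?_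
    · filter_upwards [ae_restrict_mem hs] with x hx
      have := hu0 k x (hsΩ hx)
      rw [Real.norm_eq_abs, Real.norm_eq_abs, abs_le, abs_of_pos (groundState_pos (hsΩ hx))]
      constructor <;> linarith
    · filter_upwards [ae_restrict_mem hs] with x hx
      simpa using (hu x (hsΩ hx)).sub_const (P.groundState x)
  · have hφ := P.memLp_groundGrad hN hn
    have hmu : ∀ k, AEStronglyMeasurable (fun x => gradient (u k) x - u k x • P.logGrad x)
        (volume.restrict P.domain) := fun k =>
      (testFunction_continuous_gradient (u k)).aestronglyMeasurable.sub
        ((u k).continuous.aestronglyMeasurable.smul P.aestronglyMeasurable_logGrad)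
    have hmv : ∀ k, AEStronglyMeasurable (fun x => (u k x - P.groundState x) • P.logGrad x)
        (volume.restrict P.domain) := fun k =>
      ((u k).continuous.aestronglyMeasurable.sub P.aestronglyMeasurable_groundState).smul
        P.aestronglyMeasurable_logGrad
    have h1 := tendsto_eLpNorm_of_lintegral hrem
    have h2 : Tendsto (fun k => eLpNorm (fun x => (u k x - P.groundState x) • P.logGrad x) 2
        (volume.restrict P.domain)) atTop (𝓝 0) := by
      refine tendsto_eLpNorm_of_dominated hmv hφ.norm (fun k => ?_) ?_
      · filter_upwards [ae_restrict_mem hms] with x hx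
        have := hu0 k x hx
        rw [groundGrad, norm_norm, norm_smul, norm_smul]
        refine mul_le_mul_of_nonneg_right ?_ (norm_nonneg _)
        rw [Real.norm_eq_abs, Real.norm_eq_abs, abs_le, abs_of_pos (groundState_pos hx)]
        constructor <;> linarith
      · filter_upwards [ae_restrict_mem hms] with x hx
        simpa using ((hu x hx).sub_const (P.groundState x)).smul_const (P.logGrad x)
    have h3 := h1.add h2
    rw [add_zero] at h3
    refine tendsto_of_tendsto_of_tendsto_of_le_of_le tendsto_const_nhds h3 (fun _ => zero_le)
      fun k => ?_
    refine le_trans (le_of_eq ?_) (eLpNorm_add_le (hmu k) (hmv k) (by norm_num))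
    congr 1
    ext1 x
    simp only [Pi.add_apply, groundGrad, sub_smul]
    abel

theorem memD12_groundState (hN : 2 ≤ N) (hn : 3 ≤ n) (P : PoleData N n) :
    MemD12 P.domain P.groundState P.groundGrad where
  aestronglyMeasurable := P.aestronglyMeasurable_groundState
  memLp_loc K hK hKΩ := memLp_two_of_continuousOn hK (P.contDiffOn_groundState.continuousOn.mono hKΩ)
  memLp_grad := P.memLp_groundGrad hN hn
  weakGradient := P.isWeakGradient_groundState
  approx := by
    obtain ⟨u, h1, h2⟩ := P.exists_approx_groundState hN hn
    exact ⟨u, fun K hK hKΩ => h1 K hK.measurableSet hKΩ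
      (memLp_two_of_continuousOn hK (P.contDiffOn_groundState.continuousOn.mono hKΩ)), h2⟩

theorem quotient_groundState (hN : 2 ≤ N) (hn : 3 ≤ n) (P : PoleData N n)
    (hne : (P.domain : Set (E N)).Nonempty) :
    quotient P.domain P.pole P.groundState P.groundGrad = ENNReal.ofReal (P.expo ^ 2) := by
  have h1 := P.lintegral_groundGrad_le hN (by omega)
  have h2 := le_add_self.trans (lintegral_remainder_add_le (by omega) (P.memD12_groundState hN hn))
  rw [quotient, le_antisymm h1 h2]
  exact ENNReal.mul_div_cancel_right (lintegral_groundState_ne_zero (by omega) hne)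
    (P.lintegral_groundState_ne_top hN hn)

theorem attainedInD12 (hN : 2 ≤ N) (hn : 3 ≤ n) (P : PoleData N n)
    (hne : (P.domain : Set (E N)).Nonempty) : AttainedInD12 P.domain P.pole :=
  ⟨P.groundState, P.groundGrad, P.memD12_groundState hN hn,
    nontrivial_of_pos hne fun _ hx => groundState_pos hx,
    by rw [P.quotient_groundState hN hn hne, P.hardyConstant_eq hN (by omega) hne]⟩

/-- On a bounded region the potential is bounded below. -/
theorem exists_le_potential (hn : 2 ≤ n) (P : PoleData N n)
    (hb : Bornology.IsBounded (P.domain : Set (E N))) :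
    ∃ c : ℝ, 0 < c ∧ ∀ x ∈ P.domain, c ≤ potential P.pole x := by
  obtain ⟨r, hr⟩ := hb.subset_closedBall (0 : E N)
  set i : Fin n := ⟨0, by omega⟩ with hi
  set j : Fin n := ⟨1, by omega⟩ with hj
  have h01 : i < j := by simp [hi, hj]
  have h1 : 0 < ‖P.pole i - P.pole j‖ :=
    norm_pos_iff.2 (sub_ne_zero.2 fun h => h01.ne (P.injective h))
  set S : ℝ := 1 + |r| + ‖P.pole i‖ + ‖P.pole j‖ with hS
  have hS0 : 0 < S := by positivity
  refine ⟨‖P.pole i - P.pole j‖ ^ 2 / (S ^ 2 * S ^ 2), by positivity, fun x hx => ?_⟩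
  have hxr : ‖x‖ ≤ |r| := (mem_closedBall_zero_iff.1 (hr hx)).trans (le_abs_self r)
  have hi' : ‖x - P.pole i‖ ≤ S :=
    (norm_sub_le _ _).trans (by rw [hS]; linarith [norm_nonneg (P.pole j)])
  have hj' : ‖x - P.pole j‖ ≤ S :=
    (norm_sub_le _ _).trans (by rw [hS]; linarith [norm_nonneg (P.pole i)])
  have hnn : ∀ i j, 0 ≤ ‖P.pole i - P.pole j‖ ^ 2 / (‖x - P.pole i‖ ^ 2 * ‖x - P.pole j‖ ^ 2) :=
    fun i j => by positivity
  have h2 := norm_sub_pole_pos hx i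
  have h3 := norm_sub_pole_pos hx j
  calc _ ≤ ‖P.pole i - P.pole j‖ ^ 2 / (‖x - P.pole i‖ ^ 2 * ‖x - P.pole j‖ ^ 2) := by gcongr
    _ ≤ ∑ j ∈ Finset.Ioi i, ‖P.pole i - P.pole j‖ ^ 2 /
        (‖x - P.pole i‖ ^ 2 * ‖x - P.pole j‖ ^ 2) :=
      Finset.single_le_sum (f := fun j => ‖P.pole i - P.pole j‖ ^ 2 /
        (‖x - P.pole i‖ ^ 2 * ‖x - P.pole j‖ ^ 2)) (fun j _ => hnn i j) (Finset.mem_Ioi.2 h01)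
    _ ≤ _ := Finset.single_le_sum (f := fun i => ∑ j ∈ Finset.Ioi i, ‖P.pole i - P.pole j‖ ^ 2 /
        (‖x - P.pole i‖ ^ 2 * ‖x - P.pole j‖ ^ 2))
        (fun i _ => Finset.sum_nonneg fun j _ => hnn i j) (Finset.mem_univ i)

/-- On a bounded region V ≥ c > 0, so the weighted norm ∫Vφ² controls the L² norm. -/
theorem memLp_groundState (hN : 2 ≤ N) (hn : 3 ≤ n) (P : PoleData N n)
    (hb : Bornology.IsBounded (P.domain : Set (E N))) :
    MemLp P.groundState 2 (volume.restrict P.domain) := by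
  obtain ⟨c, hc, hcV⟩ := P.exists_le_potential (by omega) hb
  refine memLp_two_of_lintegral_ne_top P.aestronglyMeasurable_groundState ?_
  refine ne_top_of_le_ne_top (ENNReal.mul_ne_top (ENNReal.ofReal_ne_top (r := c⁻¹))
    (P.lintegral_groundState_ne_top hN hn)) ?_
  rw [← lintegral_const_mul' _ _ ENNReal.ofReal_ne_top]
  refine setLIntegral_mono' P.domain.isOpen.measurableSet fun x hx => ?_
  rw [← ENNReal.ofReal_mul (by positivity), Real.norm_eq_abs, sq_abs]
  refine ENNReal.ofReal_le_ofReal ?_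
  rw [← mul_assoc]
  refine le_mul_of_one_le_left (sq_nonneg _) ?_
  rw [← div_eq_inv_mul, one_le_div hc]
  exact hcV x hx

theorem attainedInH10 (hN : 2 ≤ N) (hn : 3 ≤ n) (P : PoleData N n)
    (hne : (P.domain : Set (E N)).Nonempty) (hb : Bornology.IsBounded (P.domain : Set (E N))) :
    AttainedInH10 P.domain P.pole := by
  refine ⟨P.groundState, P.groundGrad, ⟨P.memLp_groundState hN hn hb, P.memLp_groundGrad hN hn,
    P.isWeakGradient_groundState, ?_⟩, nontrivial_of_pos hne fun _ hx => groundState_pos hx,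
    by rw [P.quotient_groundState hN hn hne, P.hardyConstant_eq hN (by omega) hne]⟩
  obtain ⟨u, h1, h2⟩ := P.exists_approx_groundState hN hn
  exact ⟨u, h1 _ P.domain.isOpen.measurableSet subset_rfl (P.memLp_groundState hN hn hb), h2⟩

end PoleData

/-! ### Functions with vanishing weak gradient on a ball -/

/-- Mollification: the derivative of the mollified function at x is the integral of f against the
gradient of a translated mollifier, which vanishes by hypothesis. The mollifications are thus
constant on slightly smaller balls and converge almost everywhere to f. -/
theorem exists_const_of_integral_smul_gradient_eq_zero_aux {Ω : Opens (E N)} {f : E N → ℝ}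
    (hf : ∀ ψ : TestFunction Ω ℝ ⊤, ∫ x in (Ω : Set (E N)), f x • gradient ψ x = 0)
    {x₀ : E N} {R : ℝ} (hR : 0 < R) (hRΩ : Metric.closedBall x₀ R ⊆ Ω)
    (hfi : IntegrableOn f (Metric.closedBall x₀ R)) :
    ∃ c, ∀ᵐ x ∂volume.restrict (Metric.ball x₀ R), f x = c := by
  set g : E N → ℝ := (Metric.closedBall x₀ R).indicator f with hg
  have hgi : Integrable g := hfi.integrable_indicator Metric.isClosed_closedBall.measurableSet
  have hgl : LocallyIntegrable g := hgi.locallyIntegrable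
  let δ : ℕ → ℝ := fun i => 1 / ((i : ℝ) + 1)
  have hδ : ∀ i, 0 < δ i := fun i => Nat.one_div_pos_of_nat
  have hδ0 : Tendsto δ atTop (𝓝 0) := tendsto_one_div_add_atTop_nhds_zero_nat
  -- The ratio of outer to inner radius stays equal to 2, as required for almost everywhere
  -- convergence of the mollifications.
  let B : ℕ → ContDiffBump (0 : E N) := fun i => ⟨δ i / 2, δ i, half_pos (hδ i), half_lt_self (hδ i)⟩
  let ρ : ℕ → E N → ℝ := fun i => (B i).normed volume
  have hρc : ∀ i, ContDiff ℝ ∞ (ρ i) := fun i => (B i).contDiff_normed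
  have hρs : ∀ i, HasCompactSupport (ρ i) := fun i => (B i).hasCompactSupport_normed
  have hρt : ∀ i z, δ i < ‖z‖ → ρ i z = 0 := by
    intro i z hz
    refine image_eq_zero_of_notMem_tsupport ?_
    rw [(B i).tsupport_normed_eq, mem_closedBall_zero_iff]
    exact not_le.2 hz
  let L := ContinuousLinearMap.lsmul ℝ ℝ (E := ℝ)
  let q : ℕ → E N → ℝ := fun i => MeasureTheory.convolution (ρ i) g L volume
  have hq : ∀ i x, HasFDerivAt (q i)
      (MeasureTheory.convolution (fderiv ℝ (ρ i)) g (L.precompL (E N)) volume x) x := fun i x =>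
    (hρs i).hasFDerivAt_convolution_left L ((hρc i).of_le (by simp)) hgl x
  have hq0 : ∀ i, ∀ x ∈ Metric.ball x₀ (R - δ i), fderiv ℝ (q i) x = 0 := by
    intro i x hx
    rw [(hq i x).fderiv]
    have hsub : Metric.closedBall x (δ i) ⊆ Metric.closedBall x₀ R := by
      refine Metric.closedBall_subset_closedBall' ?_
      linarith [Metric.mem_ball.1 hx]
    have hψ0 : ∀ y, y ∉ Metric.closedBall x (δ i) → ρ i (x - y) = 0 := by
      intro y hy
      refine hρt i _ ?_
      rwa [Metric.mem_closedBall, not_le, dist_comm, dist_eq_norm] at hy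
    -- The mollifier reflected and centered at x is admissible because its support, the closed ball
    -- of radius δ i about x, stays inside the larger closed ball.
    let ψ : TestFunction Ω ℝ ⊤ := testOf Ω (fun y => ρ i (x - y))
      (((hρc i).comp (contDiff_const.sub contDiff_id)).contDiffOn) (Metric.closedBall x (δ i))
      (isCompact_closedBall _ _) (hsub.trans hRΩ) hψ0
    have hψg : ∀ y v, inner ℝ (gradient ψ y) v = - fderiv ℝ (ρ i) (x - y) v := by
      intro y v
      have h1 : HasFDerivAt (fun y => ρ i (x - y))
          ((fderiv ℝ (ρ i) (x - y)).comp (-ContinuousLinearMap.id ℝ (E N))) y :=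
        (((hρc i).differentiable (by simp) (x - y)).hasFDerivAt).comp y
          ((hasFDerivAt_id y).const_sub x)
      have h2 : fderiv ℝ ψ y = _ := h1.fderiv
      rw [gradient, InnerProductSpace.toDual_symm_apply, h2]
      simp
    have hψz : ∀ y, y ∉ Metric.closedBall x (δ i) → gradient ψ y = 0 := by
      intro y hy
      refine testFunction_gradient_eq_zero ψ fun h => hy ?_
      exact closure_minimal (fun z hz => by
        by_contra h'
        exact hz (hψ0 z h')) Metric.isClosed_closedBall h
    have hzero : ∫ y, g y • gradient ψ y = 0 := by
      rw [← hf ψ, ← setIntegral_eq_integral_of_forall_compl_eq_zero (s := (Ω : Set (E N)))]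
      · refine setIntegral_congr_fun Ω.isOpen.measurableSet fun y _ => ?_
        by_cases hy : y ∈ Metric.closedBall x (δ i)
        · simp only [hg, Set.indicator_of_mem (hsub hy)]
        · simp only [hψz y hy, smul_zero]
      · intro y hy
        rw [hψz y fun h => hy (hRΩ (hsub h)), smul_zero]
    have hgint : Integrable fun y => g y • gradient ψ y := by
      obtain ⟨C, hC⟩ := (testFunction_continuous_gradient ψ).bounded_above_of_compact_support
        (HasCompactSupport.intro (isCompact_closedBall x (δ i)) hψz)
      exact hgi.smul_bdd C (testFunction_continuous_gradient ψ).aestronglyMeasurable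
        (ae_of_all _ hC)
    ext v
    have hex := (hρs i).fderiv (𝕜 := ℝ) |>.convolutionExists_left (L.precompL (E N))
      ((hρc i).continuous_fderiv (by simp)) hgl x
    rw [MeasureTheory.convolution, ContinuousLinearMap.integral_apply hex]
    rw [← integral_sub_left_eq_self _ volume x]
    have hpt : ∀ y, ((L.precompL (E N)) (fderiv ℝ (ρ i) (x - y))) (g (x - (x - y))) v =
        - inner ℝ v (g y • gradient ψ y) := by
      intro y
      rw [inner_smul_right, real_inner_comm, hψg, sub_sub_cancel,
        ContinuousLinearMap.precompL_apply]
      simp [L, mul_comm]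
    simp_rw [hpt]
    rw [integral_neg, integral_inner hgint, hzero, inner_zero_right, neg_zero]
    rfl
  have hae : ∀ᵐ x, Tendsto (fun i => q i x) atTop (𝓝 (g x)) :=
    ContDiffBump.ae_convolution_tendsto_right_of_locallyIntegrable (φ := B) (K := 2) hδ0
      (Eventually.of_forall fun i => by simp [B]; linarith) hgl
  have hae' := ae_restrict_of_ae (s := Metric.ball x₀ R) hae
  have hne : (ae (volume.restrict (Metric.ball x₀ R))).NeBot := by
    rw [ae_neBot, Ne, Measure.restrict_eq_zero]
    exact (Metric.measure_ball_pos volume x₀ hR).ne'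
  obtain ⟨x₁, hx₁, hx₁R⟩ := (hae'.and (ae_restrict_mem Metric.isOpen_ball.measurableSet)).exists
  refine ⟨g x₁, ?_⟩
  filter_upwards [hae', ae_restrict_mem Metric.isOpen_ball.measurableSet] with x hx hxR
  have hfx : f x = g x := by
    rw [hg, Set.indicator_of_mem (Metric.ball_subset_closedBall hxR)]
  rw [hfx]
  refine tendsto_nhds_unique hx (hx₁.congr' ?_)
  have hev : ∀ y ∈ Metric.ball x₀ R, ∀ᶠ i in atTop, y ∈ Metric.ball x₀ (R - δ i) := by
    intro y hy
    rw [Metric.mem_ball] at hy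
    filter_upwards [hδ0.eventually (gt_mem_nhds (sub_pos.2 hy))] with i hi
    rw [Metric.mem_ball]
    linarith
  filter_upwards [hev x hxR, hev x₁ hx₁R] with i h1 h2
  exact Metric.isOpen_ball.is_const_of_fderiv_eq_zero (𝕜 := ℝ)
    (convex_ball x₀ (R - δ i)).isPreconnected
    (fun y _ => (hq i y).differentiableAt.differentiableWithinAt) (hq0 i) h2 h1

/-- A function with vanishing weak gradient on a ball is constant. -/
theorem exists_const_of_integral_smul_gradient_eq_zero {x₀ : E N} {r : ℝ} (hr : 0 < r)
    {Ω : Opens (E N)} (hΩ : (Ω : Set (E N)) = Metric.ball x₀ r) {f : E N → ℝ}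
    (hf : ∀ ψ : TestFunction Ω ℝ ⊤, ∫ x in (Ω : Set (E N)), f x • gradient ψ x = 0)
    (hfi : ∀ K : Set (E N), IsCompact K → K ⊆ Ω → IntegrableOn f K) :
    ∃ c, ∀ᵐ x ∂volume.restrict (Ω : Set (E N)), f x = c := by
  -- The radii increase to r; the shift by 2 keeps s 0 = r/2 positive, so that all the balls share a
  -- common one on which the constants are compared.
  let s : ℕ → ℝ := fun m => r * (1 - 1 / ((m : ℝ) + 2))
  have hs1 : ∀ m, s m < r := by
    intro m
    have : 0 < r * (1 / ((m : ℝ) + 2)) := by positivity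
    simp only [s]
    linarith
  have hs0 : ∀ m, s 0 ≤ s m := by
    intro m
    refine mul_le_mul_of_nonneg_left (sub_le_sub_left ?_ 1) hr.le
    refine one_div_le_one_div_of_le (by norm_num) ?_
    simp
  have hs00 : 0 < s 0 := by simp only [s]; norm_num; exact hr
  have hlim : Tendsto s atTop (𝓝 r) := by
    have h1 : Tendsto (fun m : ℕ => 1 / ((m : ℝ) + 2)) atTop (𝓝 0) :=
      tendsto_const_nhds.div_atTop (tendsto_natCast_atTop_atTop.atTop_add tendsto_const_nhds)
    have := (h1.const_sub 1).const_mul r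
    rwa [sub_zero, mul_one] at this
  have hsub : ∀ m, Metric.closedBall x₀ (s m) ⊆ Ω := fun m => by
    rw [hΩ]
    exact Metric.closedBall_subset_ball (hs1 m)
  choose c hc using fun m => exists_const_of_integral_smul_gradient_eq_zero_aux hf
    (hs00.trans_le (hs0 m)) (hsub m) (hfi _ (isCompact_closedBall _ _) (hsub m))
  have hcc : ∀ m, c m = c 0 := by
    intro m
    have h1 := ae_mono (Measure.restrict_mono (Metric.ball_subset_ball (hs0 m)) le_rfl) (hc m)
    have hne : (ae (volume.restrict (Metric.ball x₀ (s 0)))).NeBot := by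
      rw [ae_neBot, Ne, Measure.restrict_eq_zero]
      exact (Metric.measure_ball_pos volume x₀ hs00).ne'
    obtain ⟨x, hx, hx'⟩ := (Eventually.and h1 (hc 0)).exists
    rw [← hx, hx']
  have hU : (Ω : Set (E N)) = ⋃ m, Metric.ball x₀ (s m) := by
    rw [hΩ]
    ext x
    simp only [Set.mem_iUnion]
    refine ⟨fun hx => ?_, fun ⟨m, hm⟩ => Metric.ball_subset_ball (hs1 m).le hm⟩
    exact (hlim.eventually (lt_mem_nhds (Metric.mem_ball.1 hx))).exists
  refine ⟨c 0, ?_⟩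
  rw [hU, ae_restrict_iUnion_iff]
  intro m
  have := hc m
  rwa [hcc m] at this

theorem integrableOn_smul_of_continuous {Ω K : Set (E N)} (hΩ : MeasurableSet Ω)
    (hK : IsCompact K) {u : E N → ℝ} (hu : MemLp u 2 (volume.restrict K))
    {w : E N → E N} (hw : Continuous w) (hw0 : ∀ x, x ∉ K → w x = 0) :
    IntegrableOn (fun x => u x • w x) Ω := by
  have : IsFiniteMeasure (volume.restrict K) := ⟨by simpa using hK.measure_lt_top⟩
  obtain ⟨C, hC⟩ := hw.bounded_above_of_compact_support (HasCompactSupport.intro hK hw0)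
  have h1 : IntegrableOn (fun x => u x • w x) K :=
    (hu.integrable (by norm_num)).smul_bdd C hw.aestronglyMeasurable (ae_of_all _ hC)
  refine h1.of_forall_sdiff_eq_zero hΩ fun x hx => ?_
  rw [hw0 x hx.2, smul_zero]

/-! ### Non-attainment on a ball with two poles -/

namespace PoleData

variable {P : PoleData N n} {x : E N}

/-- Equality in the Hardy inequality leaves no room for the remainder. Finiteness of the energy is
what allows it to be cancelled from both sides. -/
theorem ae_eq_of_lintegral_eq (hn : n ≠ 0) {u : E N → ℝ} {G : E N → E N}
    (h : MemD12 P.domain u G)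
    (heq : ∫⁻ x in (P.domain : Set (E N)), ENNReal.ofReal (‖G x‖ ^ 2) =
      ENNReal.ofReal (P.expo ^ 2) *
        ∫⁻ x in (P.domain : Set (E N)), ENNReal.ofReal (potential P.pole x * u x ^ 2)) :
    ∀ᵐ x ∂volume.restrict (P.domain : Set (E N)), G x = u x • P.logGrad x := by
  have h1 := lintegral_remainder_add_le hn h
  have hfin := lintegral_grad_ne_top h
  rw [heq] at h1 hfin
  have h2 : ∫⁻ x in (P.domain : Set (E N)), ENNReal.ofReal (‖G x - u x • P.logGrad x‖ ^ 2) = 0 := by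
    by_contra hne
    rw [add_comm] at h1
    exact (ENNReal.lt_add_right hfin hne).not_ge h1
  have hm : AEMeasurable (fun x => ENNReal.ofReal (‖G x - u x • P.logGrad x‖ ^ 2))
      (volume.restrict (P.domain : Set (E N))) := (((h.memLp_grad.1.sub
    (h.aestronglyMeasurable.smul P.aestronglyMeasurable_logGrad)).norm.pow 2).aemeasurable).ennreal_ofReal
  rw [lintegral_eq_zero_iff' hm] at h2
  filter_upwards [h2] with x hx
  simp only [Pi.zero_apply, ENNReal.ofReal_eq_zero] at hx
  have h3 : ‖G x - u x • P.logGrad x‖ = 0 := by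
    have := norm_nonneg (G x - u x • P.logGrad x)
    nlinarith
  exact sub_eq_zero.1 (norm_eq_zero.1 h3)

/-- The weak gradient of u is tested against χ = ψ/φ, for which ∇χ = ∇ψ/φ - χb; the two terms
containing b cancel. -/
theorem integral_div_groundState_smul_gradient {u : E N → ℝ} {G : E N → E N}
    (h : MemD12 P.domain u G)
    (hG : ∀ᵐ x ∂volume.restrict (P.domain : Set (E N)), G x = u x • P.logGrad x)
    (ψ : TestFunction P.domain ℝ ⊤) :
    ∫ x in (P.domain : Set (E N)), (u x / P.groundState x) • gradient ψ x = 0 := by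
  have hK : IsCompact (tsupport ψ) := ψ.hasCompactSupport
  have hKΩ := ψ.tsupport_subset
  have hinv : ContDiffOn ℝ ∞ (fun x => (P.groundState x)⁻¹) P.domain :=
    P.contDiffOn_groundState.inv fun x hx => (groundState_pos hx).ne'
  have hχ0 : ∀ x, x ∉ tsupport ψ → ψ x * (P.groundState x)⁻¹ = 0 := fun x hx => by
    rw [testFunction_eq_zero ψ hx, zero_mul]
  let χ : TestFunction P.domain ℝ ⊤ := testOf P.domain (fun x => ψ x * (P.groundState x)⁻¹)
    ((testFunction_contDiff ψ).contDiffOn.mul hinv) (tsupport ψ) hK hKΩ hχ0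
  have hχ : ∀ x, χ x = ψ x * (P.groundState x)⁻¹ := fun x => rfl
  have hχs : ∀ x, x ∉ tsupport ψ → gradient χ x = 0 := by
    intro x hx
    refine testFunction_gradient_eq_zero χ fun h => hx ?_
    exact closure_minimal (fun z hz => by
      by_contra h'
      exact hz (hχ0 z h')) (isClosed_tsupport _) h
  have hgrad : ∀ x ∈ P.domain, gradient χ x =
      (P.groundState x)⁻¹ • gradient ψ x - χ x • P.logGrad x := by
    intro x hx
    have hφ := (groundState_pos hx).ne'
    have h1 := hasGradientAt_mul (testFunction_hasGradientAt ψ x)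
      (hasGradientAt_comp (hasDerivAt_inv hφ) (hasGradientAt_groundState hx))
    have h2 : HasGradientAt χ _ x := h1
    rw [h2.gradient, hχ, smul_smul, smul_smul, sub_eq_add_neg, add_comm, ← neg_smul]
    congr 2
    field_simp
  have hweak := h.weakGradient χ
  have hwb : Continuous fun x => χ x • P.logGrad x :=
    continuous_of_continuousOn_of_eq_zero P.domain.isOpen
      (χ.continuous.continuousOn.smul P.contDiffOn_logGrad.continuousOn) hK.isClosed hKΩ
      fun x hx => by rw [hχ, hχ0 x hx, zero_smul]
  have hms := P.domain.isOpen.measurableSet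
  have hu := h.memLp_loc _ hK hKΩ
  have i1 := integrableOn_smul_of_continuous hms hK hu (testFunction_continuous_gradient χ) hχs
  have i2 := integrableOn_smul_of_continuous hms hK hu hwb
    fun x hx => by rw [hχ, hχ0 x hx, zero_smul]
  have h3 : ∫ x in (P.domain : Set (E N)), χ x • G x =
      ∫ x in (P.domain : Set (E N)), u x • χ x • P.logGrad x := by
    refine integral_congr_ae ?_
    filter_upwards [hG] with x hx
    rw [hx, smul_comm]
  have h4 : ∫ x in (P.domain : Set (E N)), (u x / P.groundState x) • gradient ψ x =
      ∫ x in (P.domain : Set (E N)), (u x • gradient χ x + u x • χ x • P.logGrad x) := by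
    refine setIntegral_congr_fun hms fun x hx => ?_
    rw [hgrad x hx, smul_sub, sub_add_cancel, smul_smul, div_eq_mul_inv]
  rw [h4, integral_add i1 i2, hweak, h3, neg_add_cancel]

/-- For n = 2 one has β = N/2, so inside a nontangential cone at a pole Vφ² is at least a multiple
of t^(-N). Balls at depth t with radius t/2 contribute a fixed positive amount while their volumes
tend to 0, which contradicts absolute continuity of a finite integral. -/
theorem lintegral_groundState_eq_top (P : PoleData N 2) {x₀ : E N} {r : ℝ} (hr : 0 < r)
    (hh : ∀ x, P.height x = r ^ 2 - ‖x - x₀‖ ^ 2) :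
    ∫⁻ x in (P.domain : Set (E N)),
      ENNReal.ofReal (potential P.pole x * P.groundState x ^ 2) = ⊤ := by
  by_contra hfin
  have hpole : ∀ i, ‖P.pole i - x₀‖ = r := by
    intro i
    have h1 : P.height (P.pole i) = 0 := P.height_pole i
    rw [hh] at h1
    exact (pow_left_inj₀ (norm_nonneg _) hr.le two_ne_zero).1 (by linarith)
  set p := P.pole 0 with hp
  set d := ‖P.pole 0 - P.pole 1‖ with hd
  have hd0 : 0 < d := norm_pos_iff.2 (sub_ne_zero.2 fun h => by simpa using P.injective h)
  let t : ℕ → ℝ := fun k => r * (1 / ((k : ℝ) + 1))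
  have ht0 : ∀ k, 0 < t k := fun k => by positivity
  have htr : ∀ k, t k ≤ r := fun k => by
    refine mul_le_of_le_one_right hr.le ?_
    rw [div_le_one (by positivity)]
    linarith [Nat.cast_nonneg (α := ℝ) k]
  have htlim : Tendsto t atTop (𝓝 0) := by
    have := (tendsto_one_div_add_atTop_nhds_zero_nat (𝕜 := ℝ)).const_mul r
    rwa [mul_zero] at this
  -- The point at distance t k from the pole p on the segment towards the center x₀.
  let z : ℕ → E N := fun k => p + (t k / r) • (x₀ - p)
  let s : ℕ → Set (E N) := fun k => Metric.ball (z k) (t k / 2)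
  have hx0 : ∀ k, ∀ x ∈ s k, ‖x - x₀‖ ≤ r - t k / 2 := by
    intro k x hx
    have h1 : x - x₀ = (x - z k) + (1 - t k / r) • (p - x₀) := by
      simp only [z, sub_smul, one_smul, smul_sub]
      abel
    have h2 : 0 ≤ 1 - t k / r := by
      rw [sub_nonneg, div_le_one hr]
      exact htr k
    have h3 : ‖x - z k‖ < t k / 2 := by rwa [← dist_eq_norm]
    rw [h1]
    refine (norm_add_le _ _).trans ?_
    rw [norm_smul, Real.norm_of_nonneg h2, hpole]
    have : (1 - t k / r) * r = r - t k := by field_simp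
    linarith
  have hxp : ∀ k, ∀ x ∈ s k, ‖x - p‖ ≤ 3 / 2 * t k := by
    intro k x hx
    have h1 : x - p = (x - z k) + (t k / r) • (x₀ - p) := by
      simp only [z]
      abel
    have h3 : ‖x - z k‖ < t k / 2 := by rwa [← dist_eq_norm]
    rw [h1]
    refine (norm_add_le _ _).trans ?_
    rw [norm_smul, Real.norm_of_nonneg (div_nonneg (ht0 k).le hr.le), norm_sub_rev x₀, hpole,
      div_mul_cancel₀ _ hr.ne']
    linarith
  have hxq : ∀ k, ∀ x ∈ s k, ‖x - P.pole 1‖ ≤ 2 * r := by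
    intro k x hx
    have h1 : x - P.pole 1 = (x - x₀) - (P.pole 1 - x₀) := by abel
    rw [h1]
    refine (norm_sub_le _ _).trans ?_
    rw [hpole]
    linarith [hx0 k x hx, ht0 k]
  have hheight : ∀ k, ∀ x ∈ s k, t k / 2 * r ≤ P.height x := by
    intro k x hx
    have h1 := hx0 k x hx
    have h2 := mul_le_mul h1 h1 (norm_nonneg _) (by linarith [htr k, ht0 k])
    rw [hh]
    nlinarith [mul_nonneg (ht0 k).le (sub_nonneg.2 (htr k)), mul_pos (ht0 k) hr]
  have hsΩ : ∀ k, s k ⊆ P.domain := fun k x hx =>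
    (mul_pos (half_pos (ht0 k)) hr).trans_le (hheight k x hx)
  -- On s k, h ≥ rt/2 and |x - p| |x - q| ≤ (3t/2)(2r) = 3rt, with q the other pole. The factor 1/36
  -- is (rt/2)² / (3rt)².
  have hpt : ∀ k, ∀ x ∈ s k, d ^ 2 / 36 / (3 * r * t k) ^ N ≤
      potential P.pole x * P.groundState x ^ 2 := by
    intro k x hx
    have hxΩ := hsΩ k hx
    have h1 := norm_sub_pole_pos hxΩ 0
    have h2 := norm_sub_pole_pos hxΩ 1
    have hV : potential P.pole x = d ^ 2 / (‖x - p‖ * ‖x - P.pole 1‖) ^ 2 := by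
      rw [potential, Fin.sum_univ_two]
      have e0 : Finset.Ioi (0 : Fin 2) = {1} := rfl
      have e1 : Finset.Ioi (1 : Fin 2) = ∅ := rfl
      rw [e0, e1, Finset.sum_singleton, Finset.sum_empty, add_zero, mul_pow]
    have hw : P.weight x ^ 2 = ((‖x - p‖ * ‖x - P.pole 1‖) ^ N)⁻¹ := by
      rw [log_weight_sq, Fin.sum_univ_two, ← Real.log_mul h1.ne' h2.ne', expo,
        ← Real.exp_log (pow_pos (mul_pos h1 h2) N), ← Real.exp_neg, Real.log_pow]
      congr 1
      push_cast
      ring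
    have h3 : ‖x - p‖ * ‖x - P.pole 1‖ ≤ 3 * r * t k := by
      refine (mul_le_mul (hxp k x hx) (hxq k x hx) h2.le (by linarith [ht0 k])).trans
        (le_of_eq ?_)
      ring
    have h4 := hheight k x hx
    have ht := ht0 k
    have h0 : 0 < ‖x - p‖ * ‖x - P.pole 1‖ := mul_pos h1 h2
    rw [groundState, mul_pow (P.height x), hV, hw]
    calc d ^ 2 / 36 / (3 * r * t k) ^ N
        = d ^ 2 / (3 * r * t k) ^ 2 * ((t k / 2 * r) ^ 2 * ((3 * r * t k) ^ N)⁻¹) := by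
          field_simp
          norm_num
      _ ≤ _ := by gcongr
  set v := volume (Metric.ball (0 : E N) 1) with hv
  have hv0 : v ≠ 0 := (Metric.measure_ball_pos volume _ one_pos).ne'
  have hvt : v ≠ ⊤ := measure_ball_lt_top.ne
  have hms : ∀ k, volume (s k) = ENNReal.ofReal ((t k / 2) ^ N) * v := by
    intro k
    rw [Measure.addHaar_ball_of_pos volume _ (half_pos (ht0 k)), finrank_euclideanSpace,
      Fintype.card_fin]
  -- In dimension 0 a sphere of positive radius is empty and could carry no pole.
  have hN : N ≠ 0 := by
    rintro rfl
    have := hpole 0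
    rw [Subsingleton.elim (P.pole 0 - x₀) 0, norm_zero] at this
    exact hr.ne this
  have hvol : Tendsto ((volume.restrict (P.domain : Set (E N))) ∘ s) atTop (𝓝 0) := by
    have h1 : Tendsto (fun k => ENNReal.ofReal ((t k / 2) ^ N) * v) atTop (𝓝 0) := by
      have h2 := (htlim.div_const 2).pow N
      rw [zero_div, zero_pow hN] at h2
      have h3 := ENNReal.Tendsto.mul_const (ENNReal.tendsto_ofReal h2) (Or.inr hvt)
      simpa using h3
    refine tendsto_of_tendsto_of_tendsto_of_le_of_le tendsto_const_nhds h1 (fun _ => zero_le)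
      fun k => ?_
    rw [← hms]
    exact Measure.restrict_apply_le _ _
  have hlim := tendsto_setLIntegral_zero hfin hvol
  have hlow : ∀ k, ENNReal.ofReal (d ^ 2 / 36 / (6 * r) ^ N) * v ≤ ∫⁻ x in s k,
      ENNReal.ofReal (potential P.pole x * P.groundState x ^ 2)
        ∂volume.restrict (P.domain : Set (E N)) := by
    intro k
    rw [Measure.restrict_restrict_of_subset (hsΩ k)]
    calc ENNReal.ofReal (d ^ 2 / 36 / (6 * r) ^ N) * v
        = ENNReal.ofReal (d ^ 2 / 36 / (3 * r * t k) ^ N) * volume (s k) := by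
          have ht := ht0 k
          rw [hms, ← mul_assoc, ← ENNReal.ofReal_mul (by positivity)]
          congr 2
          rw [div_mul_eq_mul_div, div_eq_div_iff (by positivity) (by positivity),
            mul_assoc (d ^ 2 / 36), ← mul_pow]
          congr 2
          ring
      _ = ∫⁻ _ in s k, ENNReal.ofReal (d ^ 2 / 36 / (3 * r * t k) ^ N) := by
          rw [setLIntegral_const]
      _ ≤ _ := setLIntegral_mono' Metric.isOpen_ball.measurableSet fun x hx =>
          ENNReal.ofReal_le_ofReal (hpt k x hx)
  have h5 := ge_of_tendsto' hlim hlow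
  rw [nonpos_iff_eq_zero, mul_eq_zero, ENNReal.ofReal_eq_zero] at h5
  rcases h5 with h5 | h5
  · have : 0 < d ^ 2 / 36 / (6 * r) ^ N := by positivity
    linarith
  · exact hv0 h5

/-- A minimizer has zero remainder, hence is a nonzero multiple of φ; its integral against V is
finite by the Hardy inequality, yet that of φ is infinite. -/
theorem not_attainedInH10 (hN : 2 ≤ N) (P : PoleData N 2) {x₀ : E N} {r : ℝ} (hr : 0 < r)
    (hh : ∀ x, P.height x = r ^ 2 - ‖x - x₀‖ ^ 2) : ¬ AttainedInH10 P.domain P.pole := by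
  rintro ⟨u, G, hu10, hnt, hq⟩
  have hu := hu10.memD12
  have hΩ : (P.domain : Set (E N)) = Metric.ball x₀ r := by
    ext x
    rw [Metric.mem_ball, dist_eq_norm]
    change 0 < P.height x ↔ _
    rw [hh, sub_pos, sq_lt_sq₀ (norm_nonneg _) hr.le]
  have hne : (P.domain : Set (E N)).Nonempty := hΩ ▸ Metric.nonempty_ball.2 hr
  rw [P.hardyConstant_eq hN le_rfl hne] at hq
  have hB0 := lintegral_potential_ne_zero le_rfl hu.aestronglyMeasurable hnt
  have hA := lintegral_grad_ne_top hu
  have hle := le_add_self.trans (lintegral_remainder_add_le two_ne_zero hu)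
  have hexp : ENNReal.ofReal (P.expo ^ 2) ≠ 0 := by
    have : 0 < P.expo := by unfold expo; positivity
    rw [Ne, ENNReal.ofReal_eq_zero, not_le]
    positivity
  have hBt : ∫⁻ x in (P.domain : Set (E N)),
      ENNReal.ofReal (potential P.pole x * u x ^ 2) ≠ ⊤ := by
    intro h
    rw [h, ENNReal.mul_top hexp] at hle
    exact hA (top_le_iff.1 hle)
  have hG := ae_eq_of_lintegral_eq two_ne_zero hu (by
    rw [← hq, quotient, ENNReal.div_mul_cancel hB0 hBt])
  have hms := P.domain.isOpen.measurableSet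
  obtain ⟨c, hc⟩ := exists_const_of_integral_smul_gradient_eq_zero hr hΩ
    (f := fun x => u x / P.groundState x) (integral_div_groundState_smul_gradient hu hG) (by
      intro K hK hKΩ
      have : IsFiniteMeasure (volume.restrict K) := ⟨by simpa using hK.measure_lt_top⟩
      have hinv : ContinuousOn (fun x => (P.groundState x)⁻¹) K :=
        (P.contDiffOn_groundState.continuousOn.mono hKΩ).inv₀
          fun x hx => (groundState_pos (hKΩ hx)).ne'
      obtain ⟨C, hC⟩ := hK.exists_bound_of_continuousOn hinv
      have h1 := ((hu.memLp_loc K hK hKΩ).integrable (by norm_num)).mul_bdd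
        (hinv.aestronglyMeasurable hK.measurableSet)
        (by filter_upwards [ae_restrict_mem hK.measurableSet] with x hx using hC x hx)
      simp_rw [div_eq_mul_inv]
      exact h1)
  have huc : ∀ᵐ x ∂volume.restrict (P.domain : Set (E N)), u x = c * P.groundState x := by
    filter_upwards [hc, ae_restrict_mem hms] with x hx hxΩ
    rw [← hx, div_mul_cancel₀ _ (groundState_pos hxΩ).ne']
  have hc0 : c ≠ 0 := by
    rintro rfl
    refine hnt ?_
    filter_upwards [huc] with x hx
    simp [hx]
  refine hBt ?_
  have h2 : ∫⁻ x in (P.domain : Set (E N)), ENNReal.ofReal (potential P.pole x * u x ^ 2) =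
      ENNReal.ofReal (c ^ 2) * ∫⁻ x in (P.domain : Set (E N)),
        ENNReal.ofReal (potential P.pole x * P.groundState x ^ 2) := by
    rw [← lintegral_const_mul' _ _ ENNReal.ofReal_ne_top]
    refine lintegral_congr_ae ?_
    filter_upwards [huc] with x hx
    rw [hx, ← ENNReal.ofReal_mul (sq_nonneg _)]
    congr 1
    ring
  rw [h2, P.lintegral_groundState_eq_top hr hh, ENNReal.mul_top]
  rw [Ne, ENNReal.ofReal_eq_zero, not_le]
  positivity

end PoleData

/-! ### Balls, exteriors of balls and half-spaces as quadratic regions -/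

theorem quadratic_eq_norm_sub_sq (x₀ x : E N) (s r : ℝ) :
    -s * ‖x‖ ^ 2 + inner ℝ ((2 * s) • x₀) x + s * (r ^ 2 - ‖x₀‖ ^ 2) =
      s * (r ^ 2 - ‖x - x₀‖ ^ 2) := by
  rw [norm_sub_sq_real, inner_smul_left, real_inner_comm]
  simp only [conj_trivial]
  ring

/-- Poles on a sphere: the region is the ball for `s = 1` and its exterior for `s = -1`. -/
def spherePoleData (x₀ : E N) (r s : ℝ) (a : Fin n → E N) (ha : Function.Injective a)
    (hr : ∀ i, ‖a i - x₀‖ = r) : PoleData N n where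
  curv := -s
  lin := (2 * s) • x₀
  cst := s * (r ^ 2 - ‖x₀‖ ^ 2)
  pole := a
  injective := ha
  height_pole i := by rw [quadratic_eq_norm_sub_sq, hr, sub_self, mul_zero]

theorem height_spherePoleData (x₀ : E N) (r s : ℝ) (a : Fin n → E N) (ha : Function.Injective a)
    (hr : ∀ i, ‖a i - x₀‖ = r) (x : E N) :
    (spherePoleData x₀ r s a ha hr).height x = s * (r ^ 2 - ‖x - x₀‖ ^ 2) :=
  quadratic_eq_norm_sub_sq x₀ x s r

theorem domain_spherePoleData_one {x₀ : E N} {r : ℝ} (hr0 : 0 < r) {a : Fin n → E N}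
    (ha : Function.Injective a) (hr : ∀ i, ‖a i - x₀‖ = r) :
    (spherePoleData x₀ r 1 a ha hr).domain = ballDomain x₀ r := by
  ext x
  change 0 < (spherePoleData x₀ r 1 a ha hr).height x ↔ x ∈ Metric.ball x₀ r
  rw [height_spherePoleData, one_mul, sub_pos, sq_lt_sq₀ (norm_nonneg _) hr0.le, mem_ball_iff_norm]

theorem domain_spherePoleData_neg_one {x₀ : E N} {r : ℝ} (hr0 : 0 < r) {a : Fin n → E N}
    (ha : Function.Injective a) (hr : ∀ i, ‖a i - x₀‖ = r) :
    (spherePoleData x₀ r (-1) a ha hr).domain = exteriorDomain x₀ r := by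
  ext x
  change 0 < (spherePoleData x₀ r (-1) a ha hr).height x ↔ x ∈ (Metric.closedBall x₀ r)ᶜ
  rw [height_spherePoleData, neg_one_mul, neg_sub, sub_pos, sq_lt_sq₀ hr0.le (norm_nonneg _),
    Set.mem_compl_iff, mem_closedBall_iff_norm, not_le]

/-- Poles on the boundary of a half-space. -/
def halfSpacePoleData (α : E N) (b : ℝ) (a : Fin n → E N) (ha : Function.Injective a)
    (hb : ∀ i, inner ℝ α (a i) = b) : PoleData N n where
  curv := 0
  lin := α
  cst := -b
  pole := a
  injective := ha
  height_pole i := by rw [hb]; ring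

theorem domain_halfSpacePoleData (α : E N) (b : ℝ) {a : Fin n → E N} (ha : Function.Injective a)
    (hb : ∀ i, inner ℝ α (a i) = b) :
    (halfSpacePoleData α b a ha hb).domain = halfSpaceDomain α b := by
  ext x
  change 0 < (0 : ℝ) * ‖x‖ ^ 2 + inner ℝ α x + -b ↔ b < inner ℝ α x
  constructor <;> intro h <;> linarith

theorem exteriorDomain_nonempty (hN : N ≠ 0) (x₀ : E N) {r : ℝ} (hr : 0 < r) :
    (exteriorDomain x₀ r : Set (E N)).Nonempty := by
  have : Nonempty (Fin N) := ⟨⟨0, Nat.pos_of_ne_zero hN⟩⟩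
  obtain ⟨v, hv⟩ := exists_norm_eq (E N) (by linarith : 0 ≤ r + 1)
  refine ⟨x₀ + v, ?_⟩
  change x₀ + v ∈ (Metric.closedBall x₀ r)ᶜ
  rw [Set.mem_compl_iff, mem_closedBall_iff_norm, add_sub_cancel_left, hv]
  linarith

theorem halfSpaceDomain_nonempty {α : E N} (hα : α ≠ 0) (b : ℝ) :
    (halfSpaceDomain α b : Set (E N)).Nonempty := by
  refine ⟨((b + 1) / ‖α‖ ^ 2) • α, ?_⟩
  change b < inner ℝ α (((b + 1) / ‖α‖ ^ 2) • α)
  have : ‖α‖ ≠ 0 := norm_ne_zero_iff.2 hα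
  rw [inner_smul_right, real_inner_self_eq_norm_sq, div_mul_cancel₀ _ (by positivity)]
  linarith

end MultipolarHardy

end

theorem theorem3 (N n : ℕ) (hN : 2 ≤ N) (hn : 2 ≤ n)
    (a : Fin n → EuclideanSpace ℝ (Fin N)) (ha : Function.Injective a) :
    (∀ (x₀ : EuclideanSpace ℝ (Fin N)) (r : ℝ), 0 < r →
      (∀ i, a i ∈ frontier (MultipolarHardy.ballDomain x₀ r : Set (EuclideanSpace ℝ (Fin N)))) →
        MultipolarHardy.hardyConstant (MultipolarHardy.ballDomain x₀ r) a
          = ENNReal.ofReal ((N : ℝ) ^ 2 / (n : ℝ) ^ 2) ∧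
        (MultipolarHardy.AttainedInH10 (MultipolarHardy.ballDomain x₀ r) a ↔ 3 ≤ n)) ∧
    (∀ (x₀ : EuclideanSpace ℝ (Fin N)) (r : ℝ), 0 < r →
      (∀ i, a i ∈
        frontier (MultipolarHardy.exteriorDomain x₀ r : Set (EuclideanSpace ℝ (Fin N)))) →
        MultipolarHardy.hardyConstant (MultipolarHardy.exteriorDomain x₀ r) a
          = ENNReal.ofReal ((N : ℝ) ^ 2 / (n : ℝ) ^ 2) ∧
        (3 ≤ N → 3 ≤ n →
          MultipolarHardy.AttainedInD12 (MultipolarHardy.exteriorDomain x₀ r) a)) ∧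
    (∀ (α : EuclideanSpace ℝ (Fin N)) (b : ℝ), α ≠ 0 →
      (∀ i, a i ∈
        frontier (MultipolarHardy.halfSpaceDomain α b : Set (EuclideanSpace ℝ (Fin N)))) →
        MultipolarHardy.hardyConstant (MultipolarHardy.halfSpaceDomain α b) a
          = ENNReal.ofReal ((N : ℝ) ^ 2 / (n : ℝ) ^ 2) ∧
        (3 ≤ n → MultipolarHardy.AttainedInD12 (MultipolarHardy.halfSpaceDomain α b) a)) := by
  have hexp : ∀ P : MultipolarHardy.PoleData N n,
      ENNReal.ofReal (P.expo ^ 2) = ENNReal.ofReal ((N : ℝ) ^ 2 / (n : ℝ) ^ 2) := fun P => by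
    rw [MultipolarHardy.PoleData.expo, div_pow]
  refine ⟨fun x₀ r hr hfr => ?_, fun x₀ r hr hfr => ?_, fun α b hα hfr => ?_⟩
  · have hsph : ∀ i, ‖a i - x₀‖ = r := fun i => by
      have h : a i ∈ frontier (Metric.ball x₀ r) := hfr i
      rwa [frontier_ball x₀ hr.ne', mem_sphere_iff_norm] at h
    let P := MultipolarHardy.spherePoleData x₀ r 1 a ha hsph
    have hdom : P.domain = MultipolarHardy.ballDomain x₀ r :=
      MultipolarHardy.domain_spherePoleData_one hr ha hsph
    have hne : (P.domain : Set (EuclideanSpace ℝ (Fin N))).Nonempty := by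
      rw [hdom]
      exact Metric.nonempty_ball.2 hr
    have hb : Bornology.IsBounded (P.domain : Set (EuclideanSpace ℝ (Fin N))) := by
      rw [hdom]
      exact Metric.isBounded_ball
    refine ⟨by rw [← hdom, ← hexp P]; exact P.hardyConstant_eq hN hn hne, fun h => ?_, fun h => ?_⟩
    · by_contra hn3
      obtain rfl : n = 2 := by omega
      rw [← hdom] at h
      exact P.not_attainedInH10 hN hr (fun x => by
        rw [MultipolarHardy.height_spherePoleData, one_mul]) h
    · rw [← hdom]
      exact P.attainedInH10 hN h hne hb
  · have hsph : ∀ i, ‖a i - x₀‖ = r := fun i => by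
      have h : a i ∈ frontier (Metric.closedBall x₀ r)ᶜ := hfr i
      rwa [frontier_compl, frontier_closedBall x₀ hr.ne', mem_sphere_iff_norm] at h
    let P := MultipolarHardy.spherePoleData x₀ r (-1) a ha hsph
    have hdom : P.domain = MultipolarHardy.exteriorDomain x₀ r :=
      MultipolarHardy.domain_spherePoleData_neg_one hr ha hsph
    have hne : (P.domain : Set (EuclideanSpace ℝ (Fin N))).Nonempty := by
      rw [hdom]
      exact MultipolarHardy.exteriorDomain_nonempty (by omega) x₀ hr
    rw [← hdom]
    exact ⟨by rw [← hexp P]; exact P.hardyConstant_eq hN hn hne,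
      fun _ h => P.attainedInD12 hN h hne⟩
  -- The frontier of a strict inequality between continuous functions lies in their equality set.
  · have hhyp : ∀ i, inner ℝ α (a i) = b := fun i =>
      (frontier_lt_subset_eq (f := fun _ => b) (g := fun x => inner ℝ α x) continuous_const
        (by fun_prop) (hfr i)).symm
    let P := MultipolarHardy.halfSpacePoleData α b a ha hhyp
    have hdom : P.domain = MultipolarHardy.halfSpaceDomain α b :=
      MultipolarHardy.domain_halfSpacePoleData α b ha hhyp
    have hne : (P.domain : Set (EuclideanSpace ℝ (Fin N))).Nonempty := by
      rw [hdom]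
      exact MultipolarHardy.halfSpaceDomain_nonempty hα b
    rw [← hdom]
    exact ⟨by rw [← hexp P]; exact P.hardyConstant_eq hN hn hne,
      fun h => P.attainedInD12 hN h hne⟩
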